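/- Let $N=\{1,\dots,n\}$ be a set of agents and $A$ a set of $m$ alternatives, $n,m\ge 1$. Given a distribution $F$ on $[0,\infty)$, let the values $\mathrm{val}_i(a)$ ($i\in N$, $a\in A$) be drawn independently from $F$; write $v=(\mathrm{val}_i)_{i\in N}$ and $\mathrm{sw}(a,v)=\sum_{i\in N}\mathrm{val}_i(a)$. Given $v$, let the profile $P=(\succ_i)_{i\in N}$ of strict rankings of $A$ be chosen uniformly at random from the set $\mathcal P(v)$ of profiles consistent with $v$, i.e. those with $\mathrm{val}_i(a)\ge \mathrm{val}_i(a')$ whenever $a\succ_i a'$. The average distortion of a (randomized) mechanism $\mathcal M$ on $F$ is $$\frac{\mathbb E_{v\sim F}\left[\max_{a\in A}\mathrm{sw}(a,v)\right]}{\mathbb E_{v\sim F,\,P\sim\mathcal P(v)}\left[\mathrm{sw}(\mathcal M(P,v),v)\right]},$$ where the expectation in the denominator is also over the random choices of $\mathcal M$. For $p\in[0,1]$, the mechanism $\textsc{Mean}$ for binary values that equal $1$ with probability $p$ queries each agent for the value of the alternative at position $\tau=\max\{1,\lfloor pm\rfloor\}$ of her ranking, and returns an alternative $a$ that maximizes the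 number of agents whose answer is $1$ and who rank $a$ at one of the positions $1,\dots,\tau$; ties are broken arbitrarily (on the basis of the profile and the answers). The mechanism $\textsc{RtMean}$ with thresholds $0<\ell_1<\dots<\ell_k$, $k\ge 1$, draws $t\in\{1,\dots,k\}$ uniformly at random, sets $p=\Pr_{z\sim F}[z\ge \ell_t]$, makes the queries of $\textsc{Mean}$ for this $p$ (hence exactly one query per agent), replaces each answer by $1$ if it is at least $\ell_t$ and by $0$ otherwise, and returns the alternative that $\textsc{Mean}$ selects on these answers. **Theorem.** There is an absolute constant $C>0$ such that the following holds. Let $F$ be a probability distribution on $[0,\infty)$ with mean $\mu>0$ and finite variance $\sigma^2$, and let $m\ge 1$. Then there are thresholds $0<\ell_1<\dots<\ell_k$ such that for every $n\ge 1$ and every way of breaking ties, the average distortion on $F$ of $\textsc{RtMean}$ with these thresholds, for $n$ agents and $m$ alternatives, is at most $$C\cdot\max\left\{1,\ \log m+\log\frac{\sigma^2}{\mu^2}\right\}$$ (with $\log 0=-\infty$, so that the bound is $C$ if $\sigma=0$). -/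

import Mathlib

open MeasureTheory ProbabilityTheory
open scoped NNReal ENNReal

noncomputable section

namespace AvgDistortion

/-- A ranking of the alternatives `Fin m`: it sends an alternative to its place, where place `0`
is the top of the ranking. -/
abbrev Ranking (m : ℕ) : Type := Equiv.Perm (Fin m)

/-- The position of an alternative in a ranking, counted from `1`. -/
def pos {m : ℕ} (r : Ranking m) (a : Fin m) : ℕ := (r a : ℕ) + 1

/-- The alternative at position `j`, for `1 ≤ j ≤ m`. -/
def altAt {m : ℕ} [NeZero m] (r : Ranking m) (j : ℕ) : Fin m := r.symm (Fin.ofNat m (j - 1))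

/-- One ranking for each of the agents `Fin n`. -/
abbrev Profile (n m : ℕ) : Type := Fin n → Ranking m

/-- `v i a` is the value of agent `i` for alternative `a`. -/
abbrev Valuations (n m : ℕ) : Type := Fin n → Fin m → ℝ≥0

/-- An alternative is ranked above another one only if its value is at least as large. -/
def Consistent {m : ℕ} (r : Ranking m) (u : Fin m → ℝ≥0) : Prop :=
  ∀ a b : Fin m, pos r a < pos r b → u b ≤ u a

open Classical in
/-- The (nonempty) set of profiles that are consistent with the valuations `v`. -/
def consistentProfiles {n m : ℕ} (v : Valuations n m) : Finset (Profile n m) :=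
  Finset.univ.filter fun P => ∀ i, Consistent (P i) (v i)

/-- The social welfare of an alternative. -/
def socialWelfare {n m : ℕ} (a : Fin m) (v : Valuations n m) : ℝ≥0 := ∑ i, v i a

/-- The maximum social welfare over all alternatives. -/
def maxWelfare {n m : ℕ} (v : Valuations n m) : ℝ≥0 :=
  Finset.univ.sup fun a => socialWelfare a v

/-- The law of random valuations whose entries are independent with distribution `F`. -/
def valuationLaw (n m : ℕ) (F : Measure ℝ≥0) : Measure (Valuations n m) :=
  Measure.pi fun _ : Fin n => Measure.pi fun _ : Fin m => F

/-- A randomized mechanism: for each profile and valuations, the law of the winner. -/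
abbrev Mechanism (n m : ℕ) : Type := Profile n m → Valuations n m → PMF (Fin m)

/-- The expected social welfare of the winner, over the randomness of the mechanism. -/
def winnerWelfare {n m : ℕ} (M : Mechanism n m) (P : Profile n m) (v : Valuations n m) : ℝ≥0∞ :=
  ∑ a, M P v a * (socialWelfare a v : ℝ≥0∞)

/-- The expected social welfare of the winner when the valuations `v` have independent entries
with law `F`, the profile is uniform among those consistent with `v`, and the mechanism draws its
own random bits. -/
def expectedWelfare {n m : ℕ} (M : Mechanism n m) (F : Measure ℝ≥0) : ℝ≥0∞ :=
  ∫⁻ v, ((consistentProfiles v).card : ℝ≥0∞)⁻¹ * ∑ P ∈ consistentProfiles v, winnerWelfare M P v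
    ∂(valuationLaw n m F)

/-- The expected maximum social welfare. -/
def expectedMaxWelfare (n m : ℕ) (F : Measure ℝ≥0) : ℝ≥0∞ :=
  ∫⁻ v, (maxWelfare v : ℝ≥0∞) ∂(valuationLaw n m F)

/-- The average distortion of a mechanism on the distribution `F`. The quotient is taken in
`[0, ∞]`, so it is `∞` if the mechanism achieves expected welfare `0` while the optimum is
positive. -/
def avgDistortion {n m : ℕ} (M : Mechanism n m) (F : Measure ℝ≥0) : ℝ≥0∞ :=
  expectedMaxWelfare n m F / expectedWelfare M F

/-- The answers of the agents when each of them is asked for her value for the alternative at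
position `j` of her ranking. -/
def answers {n m : ℕ} [NeZero m] (P : Profile n m) (v : Valuations n m) (j : ℕ) : Fin n → ℝ≥0 :=
  fun i => v i (altAt (P i) j)

open Classical in
/-- The implied social welfare of `a` when `x i` is the answer of agent `i` to the query for the
value of the alternative at position `j` of her ranking. -/
def impliedWelfare {n m : ℕ} (a : Fin m) (P : Profile n m) (x : Fin n → ℝ≥0) (j : ℕ) : ℕ :=
  ∑ i, if x i = 1 ∧ pos (P i) a ≤ j then 1 else 0

/-- The position that the mechanism Mean queries on the binary distribution with success
probability `p`. -/
def queryPos (m : ℕ) (p : ℝ) : ℕ := max 1 ⌊p * m⌋₊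

/-- `S` is the decision rule of the mechanism Mean for the binary distribution with success
probability `p`: from the profile and the answers to the queries at position `queryPos m p`, it
computes an alternative of maximum implied social welfare. Different such `S` are different ways
of breaking ties. -/
def IsMeanRule {n m : ℕ} (p : ℝ) (S : Profile n m → (Fin n → ℝ≥0) → Fin m) : Prop :=
  ∀ (P : Profile n m) (x : Fin n → ℝ≥0) (a : Fin m),
    impliedWelfare a P x (queryPos m p) ≤ impliedWelfare (S P x) P x (queryPos m p)

/-- The probability that a value drawn from `F` is at least `l`. -/
def tailProb (F : Measure ℝ≥0) (l : ℝ≥0) : ℝ := F.real (Set.Ici l)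

open Classical in
/-- The answer `z` to a query, read as a binary value with respect to the threshold `l`. -/
def binarize (l z : ℝ≥0) : ℝ≥0 := if l ≤ z then 1 else 0

/-- The mechanism RtMean with thresholds `l`: draw `t` uniformly at random, make the queries of
Mean for the binary distribution with success probability `tailProb F (l t)`, and apply the
decision rule `S t` of Mean to the binarized answers. -/
def rtMean {n m k : ℕ} [NeZero m] [NeZero k] (F : Measure ℝ≥0) (l : Fin k → ℝ≥0)
    (S : Fin k → Profile n m → (Fin n → ℝ≥0) → Fin m) : Mechanism n m :=
  fun P v => (PMF.uniformOfFintype (Fin k)).map fun t =>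
    S t P fun i => binarize (l t) (answers P v (queryPos m (tailProb F (l t))) i)

open Classical in
/-- `max {1, log m + log (σ² / μ²)}`, where `log 0 = -∞`. -/
def logRate (m : ℕ) (μ σ : ℝ) : ℝ :=
  if σ = 0 then 1 else max 1 (Real.log m + Real.log (σ ^ 2 / μ ^ 2))

end AvgDistortion

end

open AvgDistortion

/-!
The thresholds are `c * 2 ^ t` with `c = μ / 4` and `t < k`, where `k` is of order
`log (m σ² / μ²)`. Every value is at most `c`, plus twice the sum of the thresholds it reaches, plus
the value itself if it reaches `c * 2 ^ k`. The values below `c` contribute at most `n c` to the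
optimum, and by the variance so do those above `c * 2 ^ k`; since the optimum is at least
`n μ = 4 n c`, the thresholds account for half of it. A uniformly random threshold then loses a
factor of order `k`, provided that for each single threshold `l` the mechanism Mean gets a constant
fraction of the largest number of agents who approve a common alternative, in the sense of having
value at least `l` for it.

With `p` the probability of an approval and `τ` the queried position, an agent answers `1` exactly
if she approves at least `τ` alternatives, and then she approves all of her first `τ` places.
* Learning that an agent supports the alternative with most approvals does not make her other
  approvals more likely, because withdrawing one of them would not change the winner. So such an
  agent approves `1 + p m ≤ 3 τ` alternatives on average, and by Markov's inequality half of the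
  support of the winner comes from agents with at most `6 τ` approvals.
* By symmetry, the rankings may be taken uniform and independent of the numbers of approvals. The
  first `6 τ` places are covered by six cyclic shifts of the first `τ`, so allowing only approvals
  among the first `τ` places costs a factor of `6`.
* If `τ > 1` then `τ = ⌊p m⌋`, and the number of approvals of an agent reaches `τ` with probability
  at least `2 / 25`, as it is a sum of independent variables whose fourth central moment is bounded
  in terms of its second.
-/

namespace AvgDistortion

noncomputable section

/-! ### Anticoncentration from fourth moments -/

section FourthMoment

variable {Ω : Type*} [MeasurableSpace Ω] {ν : Measure Ω}

lemma integrable_pow_of_memLp_four [IsFiniteMeasure ν] {X : Ω → ℝ} (hX : MemLp X 4 ν) {j : ℕ}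
    (hj : j ≤ 4) :
    Integrable (fun ω => X ω ^ j) ν := by
  have h4 : Integrable (fun ω => ‖X ω‖ ^ 4) ν := by
    simpa using hX.integrable_norm_pow (p := 4) (by norm_num)
  have hnorm := integrable_norm_pow_of_le hX.aestronglyMeasurable hj h4
  exact (integrable_norm_iff (hX.aestronglyMeasurable.pow j)).1 (by simpa using hnorm)

lemma integral_sum_eq_zero {ι : Type*} {Y : ι → Ω → ℝ} (hY : ∀ i, Integrable (Y i) ν)
    (h0 : ∀ i, ∫ ω, Y i ω ∂ν = 0) (s : Finset ι) : ∫ ω, ∑ i ∈ s, Y i ω ∂ν = 0 := by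
  rw [integral_finsetSum s fun i _ => hY i, Finset.sum_eq_zero fun i _ => h0 i]

lemma integral_le_mul_measureReal [IsFiniteMeasure ν] {f : Ω → ℝ} (hf : Integrable f ν)
    {A : Set Ω} (hA : NullMeasurableSet A ν) {c : ℝ} (hle : ∀ ω ∈ A, f ω ≤ c)
    (hnonpos : ∀ ω ∉ A, f ω ≤ 0) :
    ∫ ω, f ω ∂ν ≤ c * ν.real A := by
  calc ∫ ω, f ω ∂ν ≤ ∫ ω, A.indicator (fun _ => c) ω ∂ν := by
        refine integral_mono hf ((integrable_const c).indicator₀ hA) fun ω => ?_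
        by_cases h : ω ∈ A
        · simpa [h] using hle ω h
        · simpa [h] using hnonpos ω h
    _ = c * ν.real A := by
        rw [integral_indicator₀ hA, setIntegral_const, smul_eq_mul, mul_comm]

variable [IsProbabilityMeasure ν]

lemma integral_add_pow_four_of_indepFun {X Y : Ω → ℝ} (hX : MemLp X 4 ν) (hY : MemLp Y 4 ν)
    (hXY : IndepFun X Y ν) (hX0 : ∫ ω, X ω ∂ν = 0) (hY0 : ∫ ω, Y ω ∂ν = 0) :
    ∫ ω, (X ω + Y ω) ^ 4 ∂ν =
      ∫ ω, X ω ^ 4 ∂ν + 6 * ((∫ ω, X ω ^ 2 ∂ν) * ∫ ω, Y ω ^ 2 ∂ν) + ∫ ω, Y ω ^ 4 ∂ν := by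
  have hpow (j k : ℕ) : IndepFun (fun ω => X ω ^ j) (fun ω => Y ω ^ k) ν :=
    hXY.comp (measurable_id.pow_const j) (measurable_id.pow_const k)
  have hXj {j : ℕ} (hj : j ≤ 4) := integrable_pow_of_memLp_four hX hj
  have hYk {k : ℕ} (hk : k ≤ 4) := integrable_pow_of_memLp_four hY hk
  have hmul {j k : ℕ} (hj : j ≤ 4) (hk : k ≤ 4) : Integrable (fun ω => X ω ^ j * Y ω ^ k) ν :=
    (hpow j k).integrable_mul (hXj hj) (hYk hk)
  have hprod {j k : ℕ} (hj : j ≤ 4) (hk : k ≤ 4) :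
      ∫ ω, X ω ^ j * Y ω ^ k ∂ν = (∫ ω, X ω ^ j ∂ν) * ∫ ω, Y ω ^ k ∂ν :=
    (hpow j k).integral_fun_mul_eq_mul_integral (hXj hj).aestronglyMeasurable
      (hYk hk).aestronglyMeasurable
  have hexpand (ω : Ω) : (X ω + Y ω) ^ 4 = X ω ^ 4 + 4 * (X ω ^ 3 * Y ω ^ 1) +
      6 * (X ω ^ 2 * Y ω ^ 2) + 4 * (X ω ^ 1 * Y ω ^ 3) + Y ω ^ 4 := by ring
  have i31 := (hmul (j := 3) (k := 1) (by lia) (by lia)).const_mul 4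
  have i22 := (hmul (j := 2) (k := 2) (by lia) (by lia)).const_mul 6
  have i13 := (hmul (j := 1) (k := 3) (by lia) (by lia)).const_mul 4
  have i4 := hXj le_rfl
  simp only [hexpand]
  rw [integral_add (((i4.fun_add i31).fun_add i22).fun_add i13) (hYk le_rfl),
    integral_add ((i4.fun_add i31).fun_add i22) i13, integral_add (i4.fun_add i31) i22,
    integral_add i4 i31, integral_const_mul, integral_const_mul, integral_const_mul,
    hprod (by lia) (by lia), hprod (by lia) (by lia), hprod (by lia) (by lia)]
  simp [hX0, hY0]

lemma integral_add_sq_of_indepFun {X Y : Ω → ℝ} (hX : MemLp X 2 ν) (hY : MemLp Y 2 ν)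
    (hXY : IndepFun X Y ν) (hX0 : ∫ ω, X ω ∂ν = 0) (hY0 : ∫ ω, Y ω ∂ν = 0) :
    ∫ ω, (X ω + Y ω) ^ 2 ∂ν = ∫ ω, X ω ^ 2 ∂ν + ∫ ω, Y ω ^ 2 ∂ν := by
  have hXY0 : ∫ ω, (X + Y) ω ∂ν = 0 := by
    rw [integral_add' (hX.integrable (by norm_num)) (hY.integrable (by norm_num)), hX0, hY0,
      add_zero]
  have hvar := hXY.variance_add hX hY
  rwa [variance_of_integral_eq_zero (hX.add hY).aemeasurable hXY0,
    variance_of_integral_eq_zero hX.aemeasurable hX0,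
    variance_of_integral_eq_zero hY.aemeasurable hY0] at hvar

section Sum

variable {ι : Type*} {Y : ι → Ω → ℝ}

lemma integral_sum_sq_of_iIndepFun (hY : ∀ i, MemLp (Y i) 2 ν) (hind : iIndepFun Y ν)
    (h0 : ∀ i, ∫ ω, Y i ω ∂ν = 0) (s : Finset ι) :
    ∫ ω, (∑ i ∈ s, Y i ω) ^ 2 ∂ν = ∑ i ∈ s, ∫ ω, Y i ω ^ 2 ∂ν := by
  have hvar := IndepFun.variance_sum (s := s) (fun i _ => hY i)
    fun i _ j _ hij => hind.indepFun hij
  have hcentred : ∫ ω, (∑ i ∈ s, Y i) ω ∂ν = 0 := by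
    simpa only [Finset.sum_apply] using
      integral_sum_eq_zero (fun i => (hY i).integrable (by norm_num)) h0 s
  rw [variance_of_integral_eq_zero (memLp_finsetSum' s fun i _ => hY i).aemeasurable hcentred,
    Finset.sum_congr rfl fun i _ =>
      variance_of_integral_eq_zero (hY i).aemeasurable (h0 i)] at hvar
  simpa only [Finset.sum_apply] using hvar

lemma integral_sum_pow_four_le (hY : ∀ i, MemLp (Y i) 4 ν) (hind : iIndepFun Y ν)
    (h0 : ∀ i, ∫ ω, Y i ω ∂ν = 0) (s : Finset ι) :
    ∫ ω, (∑ i ∈ s, Y i ω) ^ 4 ∂ν ≤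
      3 * (∫ ω, (∑ i ∈ s, Y i ω) ^ 2 ∂ν) ^ 2 + ∑ i ∈ s, ∫ ω, Y i ω ^ 4 ∂ν := by
  classical
  induction s using Finset.induction_on with
  | empty => simp
  | insert a s ha ih =>
    have hS : MemLp (fun ω => ∑ i ∈ s, Y i ω) 4 ν := memLp_finsetSum s fun i _ => hY i
    have hS0 : ∫ ω, ∑ i ∈ s, Y i ω ∂ν = 0 :=
      integral_sum_eq_zero (fun i => (hY i).integrable (by norm_num)) h0 s
    have hYS : IndepFun (Y a) (fun ω => ∑ i ∈ s, Y i ω) ν := by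
      simpa only [Finset.sum_fn] using
        (hind.indepFun_finsetSum_of_notMem₀ (fun i => (hY i).aemeasurable) ha).symm
    have hle : (2 : ℝ≥0∞) ≤ 4 := by norm_num
    simp only [Finset.sum_insert ha]
    rw [integral_add_pow_four_of_indepFun (hY a) hS hYS (h0 a) hS0,
      integral_add_sq_of_indepFun ((hY a).mono_exponent hle) (hS.mono_exponent hle) hYS (h0 a) hS0]
    nlinarith [sq_nonneg (∫ ω, Y a ω ^ 2 ∂ν)]

lemma integral_sum_pow_four_le_of_abs_le_one (hY : ∀ i, MemLp (Y i) 4 ν) (hind : iIndepFun Y ν)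
    (h0 : ∀ i, ∫ ω, Y i ω ∂ν = 0) (h1 : ∀ i ω, |Y i ω| ≤ 1) (s : Finset ι) :
    ∫ ω, (∑ i ∈ s, Y i ω) ^ 4 ∂ν ≤
      3 * (∫ ω, (∑ i ∈ s, Y i ω) ^ 2 ∂ν) ^ 2 + ∫ ω, (∑ i ∈ s, Y i ω) ^ 2 ∂ν := by
  refine (integral_sum_pow_four_le hY hind h0 s).trans (add_le_add_right ?_ _)
  rw [integral_sum_sq_of_iIndepFun (fun i => (hY i).mono_exponent (by norm_num)) hind h0]
  refine Finset.sum_le_sum fun i _ => integral_mono (integrable_pow_of_memLp_four (hY i) le_rfl)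
    (integrable_pow_of_memLp_four (hY i) (by lia)) fun ω => ?_
  simp only [← sq_abs (Y i ω), ← Even.pow_abs (⟨2, rfl⟩ : Even 4) (Y i ω)]
  exact pow_le_pow_of_le_one (abs_nonneg _) (h1 i ω) (by lia)

end Sum

lemma quartic_le_five (t : ℝ) : t + 4 / 5 * t ^ 2 - 2 / 25 * t ^ 4 ≤ 5 := by
  nlinarith [sq_nonneg (t ^ 2 - 6), sq_nonneg (t - 5 / 2)]

lemma quartic_nonpos {t : ℝ} (ht : t ≤ 0) : t + 4 / 5 * t ^ 2 - 2 / 25 * t ^ 4 ≤ 0 := by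
  have hcubic : 0 ≤ 1 + 4 / 5 * t - 2 / 25 * t ^ 3 := by
    nlinarith [mul_nonneg (neg_nonneg.2 ht) (sq_nonneg (t + 9 / 5))]
  nlinarith

-- The quartic above, which lies below `5 * 𝟙[t > 0]`, is integrated at `t = X / √(E X ^ 2)`.
lemma le_measureReal_pos_of_integral_pow_four_le {X : Ω → ℝ} (hX : MemLp X 4 ν)
    (h0 : ∫ ω, X ω ∂ν = 0) (hpos : 0 < ∫ ω, X ω ^ 2 ∂ν)
    (h4 : ∫ ω, X ω ^ 4 ∂ν ≤ 5 * (∫ ω, X ω ^ 2 ∂ν) ^ 2) : 2 / 25 ≤ ν.real {ω | 0 < X ω} := by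
  set V := ∫ ω, X ω ^ 2 ∂ν
  have hr : 0 < √V := Real.sqrt_pos.2 hpos
  have hr2 : √V ^ 2 = V := Real.sq_sqrt hpos.le
  have i1 := (integrable_pow_of_memLp_four hX (j := 1) (by lia)).mul_const (√V)⁻¹
  have i2 := (integrable_pow_of_memLp_four hX (j := 2) (by lia)).mul_const (4 / 5 * V⁻¹)
  have i4 := (integrable_pow_of_memLp_four hX (j := 4) le_rfl).mul_const (2 / 25 * V⁻¹ ^ 2)
  have hquartic (ω : Ω) : X ω ^ 1 * (√V)⁻¹ + X ω ^ 2 * (4 / 5 * V⁻¹) - X ω ^ 4 * (2 / 25 * V⁻¹ ^ 2)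
      = X ω / √V + 4 / 5 * (X ω / √V) ^ 2 - 2 / 25 * (X ω / √V) ^ 4 := by
    have hinv : V⁻¹ = (√V)⁻¹ ^ 2 := by rw [inv_pow, hr2]
    simp only [hinv, div_eq_mul_inv]; ring
  have hle := integral_le_mul_measureReal (c := 5) ((i1.fun_add i2).sub i4)
    (nullMeasurableSet_lt aemeasurable_const hX.aemeasurable)
    (fun ω _ => (hquartic ω).trans_le (quartic_le_five _))
    (fun ω hω => (hquartic ω).trans_le
      (quartic_nonpos (div_nonpos_of_nonpos_of_nonneg (not_lt.1 hω) hr.le)))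
  have hfourth : (∫ ω, X ω ^ 4 ∂ν) * (2 / 25 * V⁻¹ ^ 2) ≤ 2 / 5 := by
    calc _ ≤ 5 * V ^ 2 * (2 / 25 * V⁻¹ ^ 2) := by gcongr
      _ = 2 / 5 := by field_simp; norm_num
  have hsecond : V * (4 / 5 * V⁻¹) = 4 / 5 := by field_simp
  simp only [Pi.sub_apply] at hle
  rw [integral_sub (i1.fun_add i2) i4, integral_add i1 i2, integral_mul_const, integral_mul_const,
    integral_mul_const, hsecond] at hle
  simp only [pow_one, h0] at hle
  linarith

lemma le_measureReal_neg_one_lt_of_integral_pow_four_le {X : Ω → ℝ} (hX : MemLp X 4 ν)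
    (h0 : ∫ ω, X ω ∂ν = 0)
    (h4 : ∫ ω, X ω ^ 4 ∂ν ≤ 3 * (∫ ω, X ω ^ 2 ∂ν) ^ 2 + ∫ ω, X ω ^ 2 ∂ν) :
    2 / 25 ≤ ν.real {ω | -1 < X ω} := by
  rcases lt_or_ge (∫ ω, X ω ^ 2 ∂ν) (1 / 2) with hsmall | hlarge
  · have i2 := integrable_pow_of_memLp_four hX (j := 2) (by lia)
    have hle := integral_le_mul_measureReal (c := 1) ((integrable_const 1).sub i2)
      (nullMeasurableSet_lt aemeasurable_const hX.aemeasurable (f := fun _ => (-1 : ℝ)))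
      (fun ω _ => by simp [sq_nonneg]) (fun ω hω => ?_)
    · simp only [Pi.sub_apply] at hle
      rw [integral_sub (integrable_const 1) i2] at hle
      simp only [integral_const, probReal_univ, smul_eq_mul, one_mul] at hle
      linarith
    · have hω' : X ω ≤ -1 := not_lt.1 hω
      simp only [Pi.sub_apply]
      nlinarith
  · refine (le_measureReal_pos_of_integral_pow_four_le hX h0 (by linarith) (by nlinarith)).trans ?_
    exact measureReal_mono fun ω (hω : 0 < X ω) => neg_one_lt_zero.trans hω

lemma integral_indicator_one_sub {α : Type*} [MeasurableSpace α] (F : Measure α)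
    [IsProbabilityMeasure F] {s : Set α} (hs : MeasurableSet s) :
    ∫ z, (s.indicator 1 z - F.real s) ∂F = 0 := by
  have hint : Integrable (s.indicator (1 : α → ℝ)) F := (integrable_const 1).indicator hs
  rw [integral_sub hint (integrable_const _), integral_indicator_one hs]
  simp

lemma abs_indicator_one_sub_le_one {α : Type*} (s : Set α) {p : ℝ} (hp0 : 0 ≤ p) (hp1 : p ≤ 1)
    (z : α) : |s.indicator 1 z - p| ≤ 1 := by
  rw [abs_le]
  by_cases h : z ∈ s <;> simp only [h, Set.indicator_of_mem, Set.indicator_of_notMem,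
    not_false_eq_true, Pi.one_apply] <;> constructor <;> linarith

lemma le_measureReal_floor_le_card {ι α : Type*} [Fintype ι] [MeasurableSpace α]
    (F : Measure α) [IsProbabilityMeasure F] {s : Set α} (hs : MeasurableSet s) :
    2 / 25 ≤ (Measure.pi fun _ : ι => F).real
      {u | ⌊F.real s * Fintype.card ι⌋₊ ≤ Nat.card {a // u a ∈ s}} := by
  classical
  set p := F.real s
  have hp : 0 ≤ p := measureReal_nonneg
  let y : α → ℝ := fun z => s.indicator 1 z - p
  have hym : Measurable y := (measurable_one.indicator hs).sub measurable_const
  have hy1 (z : α) : |y z| ≤ 1 := abs_indicator_one_sub_le_one s hp measureReal_le_one z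
  let Y : ι → (ι → α) → ℝ := fun a u => y (u a)
  have hY (a : ι) : MemLp (Y a) 4 (Measure.pi fun _ : ι => F) :=
    MemLp.of_bound (hym.comp (measurable_pi_apply a)).aestronglyMeasurable 1
      (ae_of_all _ fun u => hy1 (u a))
  have hY0 (a : ι) : ∫ u, Y a u ∂(Measure.pi fun _ : ι => F) = 0 :=
    (integral_comp_eval (μ := fun _ : ι => F) hym.aestronglyMeasurable).trans
      (integral_indicator_one_sub F hs)
  have hind : iIndepFun Y (Measure.pi fun _ : ι => F) := iIndepFun_pi fun _ => hym.aemeasurable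
  have hsum (u : ι → α) : ∑ a, Y a u = Nat.card {a // u a ∈ s} - p * Fintype.card ι := by
    simp only [Y, y, Finset.sum_sub_distrib]
    simp [Set.indicator_apply, Fintype.card_subtype, mul_comm]
  refine (le_measureReal_neg_one_lt_of_integral_pow_four_le
    (memLp_finsetSum Finset.univ fun a _ => hY a)
    (integral_sum_eq_zero (fun a => (hY a).integrable (by norm_num)) hY0 _)
    (integral_sum_pow_four_le_of_abs_le_one hY hind hY0 (fun a u => hy1 (u a)) _)).trans
    (measureReal_mono fun u hu => ?_)
  rw [Set.mem_ofPred_eq, hsum] at hu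
  have hfloor := Nat.floor_le (show 0 ≤ p * Fintype.card ι by positivity)
  have hlt : (⌊p * Fintype.card ι⌋₊ : ℝ) < (Nat.card {a // u a ∈ s} + 1 : ℕ) := by
    push_cast; linarith
  exact Nat.lt_succ_iff.1 (by exact_mod_cast hlt)

end FourthMoment

/-! ### Sections of product measures, and Markov's inequality -/

section Measure

variable {α : Type*} [MeasurableSpace α]

lemma measure_pi_le_mul_of_forall_update {ι : Type*} [Fintype ι] [DecidableEq ι] {X : ι → Type*}
    [∀ i, MeasurableSpace (X i)] {μ : ∀ i, Measure (X i)} [∀ i, SigmaFinite (μ i)] (i : ι)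
    {D E : Set (∀ i, X i)} (hD : MeasurableSet D) (hE : MeasurableSet E) {c : ℝ≥0∞}
    (h : ∀ x, μ i {z | Function.update x i z ∈ D} ≤ c * μ i {z | Function.update x i z ∈ E}) :
    Measure.pi μ D ≤ c * Measure.pi μ E := by
  have hindE : Measurable (E.indicator (1 : (∀ i, X i) → ℝ≥0∞)) := measurable_one.indicator hE
  rw [← lintegral_indicator_one hD, ← lintegral_indicator_one hE, ← lintegral_const_mul _ hindE]
  refine lintegral_le_of_lmarginal_le {i} (measurable_one.indicator hD) (hindE.const_mul c) ?_
  rw [lmarginal_singleton, lmarginal_singleton]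
  intro x
  have hslice {B : Set (∀ i, X i)} (hB : MeasurableSet B) :
      ∫⁻ z, B.indicator 1 (Function.update x i z) ∂μ i = μ i {z | Function.update x i z ∈ B} :=
    lintegral_indicator_one (measurable_update x hB)
  have hEx : Measurable fun z => E.indicator (1 : (∀ i, X i) → ℝ≥0∞) (Function.update x i z) :=
    hindE.comp (measurable_update x)
  simpa only [lintegral_const_mul c hEx, hslice hD, hslice hE] using h x

lemma measure_pi_pi_inter_le {ι κ : Type*} [Fintype ι] [Fintype κ] [DecidableEq ι] [DecidableEq κ]
    (F : Measure α) [IsProbabilityMeasure F] (i : ι) (a : κ) {E : Set (ι → κ → α)}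
    (hE : MeasurableSet E) {B : Set α} (hB : MeasurableSet B)
    (h : ∀ v ∈ E, v i a ∈ B → ∀ z, Function.update v i (Function.update (v i) a z) ∈ E) :
    (Measure.pi fun _ : ι => Measure.pi fun _ : κ => F) (E ∩ {v | v i a ∈ B}) ≤
      F B * (Measure.pi fun _ : ι => Measure.pi fun _ : κ => F) E := by
  have hEB : MeasurableSet (E ∩ {v | v i a ∈ B}) :=
    hE.inter (((measurable_pi_apply a).comp (measurable_pi_apply i)) hB)
  refine measure_pi_le_mul_of_forall_update i hEB hE fun v => ?_
  refine measure_pi_le_mul_of_forall_update a (measurable_update v hEB) (measurable_update v hE)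
    fun u => ?_
  set D : Set α := {z | Function.update v i (Function.update u a z) ∈ E}
  suffices hDB : F (D ∩ B) ≤ F B * F D by
    have hslice : {z | Function.update u a z ∈ Function.update v i ⁻¹' (E ∩ {w | w i a ∈ B})} =
        D ∩ B := by
      ext z
      simp [D]
    exact (congrArg F hslice).trans_le hDB
  rcases (D ∩ B).eq_empty_or_nonempty with hempty | ⟨z, hzD, hzB⟩
  · simp [hempty]
  · have hD : D = Set.univ := Set.eq_univ_of_forall fun z' => by
      simpa [D] using h _ hzD (by simpa using hzB) z'
    simp [hD]

lemma measure_le_two_mul_measure_inter_le {ν : Measure α} {s : Set α} (hs : ν s ≠ ∞)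
    {f : α → ℝ≥0∞} (hf : Measurable f) {c : ℝ≥0∞} (hc0 : c ≠ 0) (hc : c ≠ ∞)
    (h : 2 * ∫⁻ x in s, f x ∂ν ≤ c * ν s) : ν s ≤ 2 * ν (s ∩ {x | f x ≤ c}) := by
  have hmarkov : 2 * ν (s ∩ {x | c ≤ f x}) ≤ ν s := by
    refine (ENNReal.mul_le_mul_iff_right hc0 hc).1 (le_trans ?_ h)
    rw [mul_left_comm]
    gcongr
    simpa only [Measure.restrict_apply (measurableSet_le measurable_const hf), Set.inter_comm] using
      mul_meas_ge_le_lintegral (μ := ν.restrict s) hf c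
  have hsplit : ν s ≤ ν (s ∩ {x | f x ≤ c}) + ν (s ∩ {x | c ≤ f x}) := by
    refine (measure_mono fun x hx => ?_).trans (measure_union_le _ _)
    exact (le_total (f x) c).imp (fun hle => ⟨hx, hle⟩) fun hge => ⟨hx, hge⟩
  refine (ENNReal.add_le_add_iff_right hs).1 ?_
  calc ν s + ν s = 2 * ν s := (two_mul _).symm
    _ ≤ 2 * (ν (s ∩ {x | f x ≤ c}) + ν (s ∩ {x | c ≤ f x})) := by gcongr
    _ ≤ 2 * ν (s ∩ {x | f x ≤ c}) + ν s := by rw [mul_add]; gcongr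

end Measure

/-! ### Iverson brackets, loads and averages -/

open Classical in
/-- The Iverson bracket of a proposition: `1` if it holds, and `0` otherwise. -/
def ind (p : Prop) : ℝ≥0∞ := if p then 1 else 0

lemma ind_of {p : Prop} (h : p) : ind p = 1 := if_pos h

lemma ind_of_not {p : Prop} (h : ¬p) : ind p = 0 := if_neg h

lemma ind_le {p : Prop} {c : ℝ≥0∞} (h : p → 1 ≤ c) : ind p ≤ c := by
  by_cases hp : p
  · exact (ind_of hp).trans_le (h hp)
  · exact (ind_of_not hp).trans_le zero_le

lemma ind_mono {p q : Prop} (h : p → q) : ind p ≤ ind q :=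
  ind_le fun hp => (ind_of (h hp)).ge

lemma measurable_ind {α : Type*} [MeasurableSpace α] {s : Set α} (hs : MeasurableSet s) :
    Measurable fun x => ind (x ∈ s) :=
  Measurable.ite hs measurable_const measurable_const

lemma lintegral_ind {α : Type*} [MeasurableSpace α] (ν : Measure α) {s : Set α}
    (hs : MeasurableSet s) : ∫⁻ x, ind (x ∈ s) ∂ν = ν s := by
  rw [← lintegral_indicator_one hs]
  refine lintegral_congr fun x => ?_
  by_cases h : x ∈ s <;> simp [ind, h]

lemma lintegral_sum_sum_ind {α ι κ : Type*} [Fintype ι] [Fintype κ] [MeasurableSpace α]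
    {ν : Measure α} {s : κ → ι → Set α} (hs : ∀ b i, MeasurableSet (s b i)) :
    ∫⁻ x, ∑ b, ∑ i, ind (x ∈ s b i) ∂ν = ∑ b, ∑ i, ν (s b i) := by
  have hind (b : κ) (i : ι) := measurable_ind (hs b i)
  rw [lintegral_finsetSum _ fun b _ => Finset.measurable_sum _ fun i _ => hind b i]
  simp only [lintegral_finsetSum _ fun i _ => hind _ i, lintegral_ind _ (hs _ _)]

section MaxLoad

variable {ι κ : Type*} [Fintype ι]

/-- The largest column sum of a family of extended nonnegative numbers. With `X i a` the support
of agent `i` for alternative `a`, it is the support of the most supported alternative. -/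
def maxLoad (X : ι → κ → ℝ≥0∞) : ℝ≥0∞ := ⨆ a, ∑ i, X i a

lemma le_maxLoad (X : ι → κ → ℝ≥0∞) (a : κ) : ∑ i, X i a ≤ maxLoad X :=
  le_iSup (fun a => ∑ i, X i a) a

lemma maxLoad_le {X : ι → κ → ℝ≥0∞} {c : ℝ≥0∞} (h : ∀ a, ∑ i, X i a ≤ c) : maxLoad X ≤ c :=
  iSup_le h

lemma maxLoad_mono {X Y : ι → κ → ℝ≥0∞} (h : ∀ i a, X i a ≤ Y i a) : maxLoad X ≤ maxLoad Y :=
  iSup_mono fun a => Finset.sum_le_sum fun i _ => h i a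

lemma maxLoad_sum_le {β : Type*} (s : Finset β) (X : β → ι → κ → ℝ≥0∞) :
    maxLoad (fun i a => ∑ j ∈ s, X j i a) ≤ ∑ j ∈ s, maxLoad (X j) := by
  refine maxLoad_le fun a => ?_
  rw [Finset.sum_comm]
  exact Finset.sum_le_sum fun j _ => le_maxLoad (X j) a

lemma maxLoad_add_le (X Y : ι → κ → ℝ≥0∞) :
    maxLoad (fun i a => X i a + Y i a) ≤ maxLoad X + maxLoad Y := by
  refine maxLoad_le fun a => ?_
  rw [Finset.sum_add_distrib]
  exact add_le_add (le_maxLoad X a) (le_maxLoad Y a)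

lemma maxLoad_const_mul (c : ℝ≥0∞) (X : ι → κ → ℝ≥0∞) :
    maxLoad (fun i a => c * X i a) = c * maxLoad X := by
  simp only [maxLoad, ← Finset.mul_sum, ENNReal.mul_iSup]

lemma maxLoad_le_sum [Fintype κ] (X : ι → κ → ℝ≥0∞) : maxLoad X ≤ ∑ a, ∑ i, X i a :=
  maxLoad_le fun a =>
    Finset.single_le_sum (f := fun a => ∑ i, X i a) (fun _ _ => zero_le) (Finset.mem_univ a)

variable {α : Type*} [MeasurableSpace α] {X : α → ι → κ → ℝ≥0∞}

lemma measurable_maxLoad [Countable κ] (h : ∀ i a, Measurable fun x => X x i a) :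
    Measurable fun x => maxLoad (X x) :=
  Measurable.iSup fun a => Finset.measurable_sum _ fun i _ => h i a

lemma maxLoad_lintegral_le {ν : Measure α} (h : ∀ i a, Measurable fun x => X x i a) :
    maxLoad (fun i a => ∫⁻ x, X x i a ∂ν) ≤ ∫⁻ x, maxLoad (X x) ∂ν :=
  maxLoad_le fun a => by
    rw [← lintegral_finsetSum _ fun i _ => h i a]
    exact lintegral_mono fun x => le_maxLoad (X x) a

end MaxLoad

section Avg

variable {β : Type*}

/-- The average of `f` over the finite set `s`, equal to `0` if `s` is empty. -/
def avg (s : Finset β) (f : β → ℝ≥0∞) : ℝ≥0∞ := (s.card : ℝ≥0∞)⁻¹ * ∑ x ∈ s, f x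

lemma avg_mono {s : Finset β} {f g : β → ℝ≥0∞} (h : ∀ x ∈ s, f x ≤ g x) :
    avg s f ≤ avg s g := by
  unfold avg
  gcongr with x hx
  exact h x hx

lemma avg_congr {s : Finset β} {f g : β → ℝ≥0∞} (h : ∀ x ∈ s, f x = g x) : avg s f = avg s g := by
  rw [avg, avg, Finset.sum_congr rfl h]

lemma avg_const {s : Finset β} (hs : s.Nonempty) (c : ℝ≥0∞) : avg s (fun _ => c) = c := by
  rw [avg, Finset.sum_const, nsmul_eq_mul, ← mul_assoc,
    ENNReal.inv_mul_cancel (by simpa using hs.ne_empty) (ENNReal.natCast_ne_top _), one_mul]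

lemma avg_const_mul (s : Finset β) (c : ℝ≥0∞) (f : β → ℝ≥0∞) :
    avg s (fun x => c * f x) = c * avg s f := by
  rw [avg, avg, ← Finset.mul_sum, mul_left_comm]

lemma avg_sum {γ : Type*} (s : Finset β) (t : Finset γ) (f : γ → β → ℝ≥0∞) :
    avg s (fun x => ∑ j ∈ t, f j x) = ∑ j ∈ t, avg s (f j) := by
  simp only [avg, Finset.sum_comm (s := s), Finset.mul_sum]

lemma avg_comm {γ : Type*} (s : Finset β) (t : Finset γ) (f : β → γ → ℝ≥0∞) :
    avg s (fun x => avg t (f x)) = avg t fun y => avg s fun x => f x y := by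
  rw [avg, avg]
  simp only [avg, ← Finset.mul_sum]
  rw [Finset.sum_comm, mul_left_comm]

lemma avg_univ_comp_equiv [Fintype β] (e : β ≃ β) (f : β → ℝ≥0∞) :
    avg Finset.univ (fun x => f (e x)) = avg Finset.univ f := by
  rw [avg, avg, Equiv.sum_comp e f]

lemma lintegral_avg {α : Type*} [MeasurableSpace α] (ν : Measure α) (s : Finset β)
    {f : α → β → ℝ≥0∞} (hf : ∀ x, Measurable fun v => f v x) :
    ∫⁻ v, avg s (f v) ∂ν = avg s fun x => ∫⁻ v, f v x ∂ν := by
  unfold avg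
  rw [lintegral_const_mul _ (Finset.measurable_sum _ fun x _ => hf x),
    lintegral_finsetSum _ fun x _ => hf x]

lemma measurable_avg {α : Type*} [MeasurableSpace α] [Finite β] {s : α → Finset β}
    (hs : ∀ x, MeasurableSet {v | x ∈ s v}) {f : α → β → ℝ≥0∞}
    (hf : ∀ x, Measurable fun v => f v x) : Measurable fun v => avg (s v) (f v) := by
  classical
  have := Fintype.ofFinite β
  have hsum (v : α) (g : β → ℝ≥0∞) : ∑ x ∈ s v, g x = ∑ x, ind (x ∈ s v) * g x := by
    simp [ind]
  have havg (v : α) : avg (s v) (f v) = (∑ x, ind (x ∈ s v))⁻¹ * ∑ x, ind (x ∈ s v) * f v x := by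
    rw [avg, ← hsum]
    congr 2
    simpa using hsum v 1
  simp only [havg]
  exact (Finset.measurable_sum _ fun x _ => measurable_ind (hs x)).inv.mul
    (Finset.measurable_sum _ fun x _ => (measurable_ind (hs x)).mul (hf x))

end Avg

/-! ### Consistent profiles -/

section CountGE

variable {ι : Type*} (l : ℝ≥0)

/-- The number of indices at which a vector is at least `l`: for the row of an agent, the number of
alternatives that she approves at the threshold `l`; for the column of an alternative, the number
of agents who approve it. -/
def countGE (u : ι → ℝ≥0) : ℕ := Nat.card {a // l ≤ u a}

lemma countGE_comp_perm (u : ι → ℝ≥0) (π : Equiv.Perm ι) : countGE l (u ∘ π) = countGE l u :=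
  Nat.card_congr (π.subtypeEquiv fun _ => Iff.rfl)

lemma countGE_mono [Finite ι] {u w : ι → ℝ≥0} (h : ∀ a, l ≤ u a → l ≤ w a) :
    countGE l u ≤ countGE l w :=
  Nat.card_le_card_of_injective _ (Subtype.impEmbedding _ _ h).injective

lemma coe_countGE [Fintype ι] (u : ι → ℝ≥0) : (countGE l u : ℝ≥0∞) = ∑ a, ind (l ≤ u a) := by
  classical
  rw [countGE, Nat.card_eq_fintype_card, Fintype.card_subtype, Finset.card_filter]
  simp only [ind, Nat.cast_sum, Nat.cast_ite, Nat.cast_one, Nat.cast_zero]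
  congr

lemma measurable_countGE [Finite ι] : Measurable (countGE l : (ι → ℝ≥0) → ℕ) := by
  classical
  have := Fintype.ofFinite ι
  have hsum : (countGE l : (ι → ℝ≥0) → ℕ) = fun u => ∑ a, if l ≤ u a then 1 else 0 := by
    ext u
    simp [countGE, Fintype.card_subtype]
  rw [hsum]
  exact Finset.measurable_sum _ fun a _ =>
    Measurable.ite (measurableSet_le measurable_const (measurable_pi_apply a))
      measurable_const measurable_const

end CountGE

variable {n m : ℕ}

section Consistent

variable {r : Ranking m} {u : Fin m → ℝ≥0}

lemma Consistent.antitone (h : Consistent r u) : Antitone (u ∘ r.symm) := by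
  intro x y hxy
  rcases hxy.eq_or_lt with rfl | hlt
  · exact le_rfl
  · exact h _ _ (by simpa [pos] using hlt)

lemma Consistent.le_iff (h : Consistent r u) (l : ℝ≥0) (a : Fin m) :
    l ≤ u a ↔ (r a : ℕ) < countGE l u := by
  have hcount := Tuple.lt_card_ge_iff_apply_ge_of_antitone (j := r a) (a := l) h.antitone
  rw [← countGE_comp_perm l u r.symm, countGE, Nat.card_eq_fintype_card, Fintype.card_subtype]
  simpa using hcount.symm

lemma exists_consistent (u : Fin m → ℝ≥0) : ∃ r : Ranking m, Consistent r u := by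
  let f : Fin m → ℝ≥0ᵒᵈ := fun a => OrderDual.toDual (u a)
  refine ⟨(Tuple.sort f).symm, fun a b hab => ?_⟩
  have hplace : (Tuple.sort f).symm a ≤ (Tuple.sort f).symm b :=
    (Fin.lt_def.2 (Nat.lt_of_succ_lt_succ hab)).le
  simpa [f] using Tuple.monotone_sort f hplace

end Consistent

lemma mem_consistentProfiles {v : Valuations n m} {P : Profile n m} :
    P ∈ consistentProfiles v ↔ ∀ i, Consistent (P i) (v i) := by
  simp [consistentProfiles]

lemma consistentProfiles_nonempty (v : Valuations n m) : (consistentProfiles v).Nonempty := by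
  choose r hr using fun i => exists_consistent (v i)
  exact ⟨r, mem_consistentProfiles.2 hr⟩

lemma measurableSet_mem_consistentProfiles (P : Profile n m) :
    MeasurableSet {v : Valuations n m | P ∈ consistentProfiles v} := by
  have hInter : {v : Valuations n m | P ∈ consistentProfiles v} =
      ⋂ i, ⋂ a, ⋂ b, ⋂ (_ : pos (P i) a < pos (P i) b), {v | v i b ≤ v i a} := by
    ext v
    simp [mem_consistentProfiles, Consistent]
  rw [hInter]
  refine MeasurableSet.iInter fun i => MeasurableSet.iInter fun a => MeasurableSet.iInter fun b =>
    MeasurableSet.iInter fun _ => measurableSet_le ?_ ?_ <;> fun_prop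

/-- Permute the values of each agent `i` by `Q i`. -/
def permute (Q : Profile n m) (v : Valuations n m) : Valuations n m := fun i => v i ∘ Q i

lemma mem_consistentProfiles_permute (v : Valuations n m) (P Q : Profile n m) :
    P * Q ∈ consistentProfiles (permute Q v) ↔ P ∈ consistentProfiles v := by
  simp only [mem_consistentProfiles]
  refine forall_congr' fun i => ⟨fun h a b hab => ?_, fun h a b hab => h _ _ hab⟩
  simpa [permute] using h ((Q i).symm a) ((Q i).symm b) (by simpa [pos] using hab)

lemma avg_consistentProfiles_permute (v : Valuations n m) (Q : Profile n m)
    (f : Profile n m → ℝ≥0∞) :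
    avg (consistentProfiles (permute Q v)) f = avg (consistentProfiles v) fun P => f (P * Q) := by
  have hmap : consistentProfiles (permute Q v) =
      (consistentProfiles v).map (Equiv.mulRight Q).toEmbedding := by
    ext P
    rw [Finset.mem_map_equiv, ← mem_consistentProfiles_permute v _ Q]
    simp
  simp only [avg, hmap, Finset.card_map, Finset.sum_map, Equiv.coe_toEmbedding,
    Equiv.coe_mulRight]

lemma avg_univ_avg_consistentProfiles (v : Valuations n m) (f : Profile n m → ℝ≥0∞) :
    avg Finset.univ (fun Q => avg (consistentProfiles v) fun P => f (P * Q)) =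
      avg Finset.univ f := by
  rw [avg_comm]
  simp only [← Equiv.coe_mulLeft, avg_univ_comp_equiv]
  exact avg_const (consistentProfiles_nonempty v) _

section ValuationLaw

variable (F : Measure ℝ≥0) [IsProbabilityMeasure F]

instance : IsProbabilityMeasure (valuationLaw n m F) := by
  unfold valuationLaw
  infer_instance

lemma measurePreserving_permute (Q : Profile n m) :
    MeasurePreserving (permute Q) (valuationLaw n m F) (valuationLaw n m F) := by
  refine measurePreserving_pi (f := fun i (u : Fin m → ℝ≥0) => u ∘ Q i) _ _ fun i => ?_
  convert measurePreserving_piCongrLeft (fun _ : Fin m => F) (Q i).symm using 1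
  funext u a
  simp [MeasurableEquiv.coe_piCongrLeft, Equiv.piCongrLeft, Equiv.piCongrLeft']

lemma lintegral_avg_consistentProfiles {f : Valuations n m → Profile n m → ℝ≥0∞}
    (hf : ∀ P, Measurable fun v => f v P) (hinv : ∀ v Q, f (permute Q v) = f v) :
    ∫⁻ v, avg (consistentProfiles v) (f v) ∂valuationLaw n m F =
      ∫⁻ v, avg Finset.univ (f v) ∂valuationLaw n m F := by
  have hmeas (Q : Profile n m) :
      Measurable fun v => avg (consistentProfiles v) fun P => f v (P * Q) :=
    measurable_avg measurableSet_mem_consistentProfiles fun P => hf _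
  have hshift (Q : Profile n m) : ∫⁻ v, avg (consistentProfiles v) (f v) ∂valuationLaw n m F =
      ∫⁻ v, avg (consistentProfiles v) (fun P => f v (P * Q)) ∂valuationLaw n m F := by
    rw [← (measurePreserving_permute F Q).lintegral_comp
      (measurable_avg measurableSet_mem_consistentProfiles hf)]
    simp only [avg_consistentProfiles_permute, hinv]
  calc ∫⁻ v, avg (consistentProfiles v) (f v) ∂valuationLaw n m F
      = avg Finset.univ fun Q : Profile n m =>
          ∫⁻ v, avg (consistentProfiles v) (fun P => f v (P * Q)) ∂valuationLaw n m F := by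
        rw [avg_congr fun Q _ => (hshift Q).symm, avg_const Finset.univ_nonempty]
    _ = ∫⁻ v, avg Finset.univ (fun Q => avg (consistentProfiles v) fun P => f v (P * Q))
          ∂valuationLaw n m F := (lintegral_avg _ _ hmeas).symm
    _ = ∫⁻ v, avg Finset.univ (f v) ∂valuationLaw n m F := by
        simp only [avg_univ_avg_consistentProfiles]

end ValuationLaw

/-! ### The supporters of the winning alternative -/

section IsFirstMax

variable {κ : Type*} [LinearOrder κ] {g : κ → ℕ} {b c : κ}

/-- `b` is the first of the maximizers of `g`. Breaking ties by the order makes it unique. -/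
def IsFirstMax (g : κ → ℕ) (b : κ) : Prop := ∀ c, g c < g b ∨ g c = g b ∧ b ≤ c

lemma exists_isFirstMax [Finite κ] [Nonempty κ] (g : κ → ℕ) : ∃ b, IsFirstMax g b := by
  obtain ⟨b, hb⟩ := Finite.exists_max fun c => toLex (g c, OrderDual.toDual c)
  exact ⟨b, fun c => by simpa [Prod.Lex.le_iff] using hb c⟩

lemma IsFirstMax.le (hb : IsFirstMax g b) (c : κ) : g c ≤ g b :=
  (hb c).elim le_of_lt fun h => h.1.le

lemma IsFirstMax.eq (hb : IsFirstMax g b) (hc : IsFirstMax g c) : b = c :=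
  le_antisymm ((hb c).elim (fun h => absurd h (hc.le b).not_gt) And.right)
    ((hc b).elim (fun h => absurd h (hb.le c).not_gt) And.right)

lemma IsFirstMax.of_le {g' : κ → ℕ} (hb : IsFirstMax g b) (heq : g' b = g b)
    (hle : ∀ c, g' c ≤ g c) : IsFirstMax g' b := fun c => by
  rw [heq]
  rcases hb c with hlt | ⟨hgc, hbc⟩
  · exact Or.inl ((hle c).trans_lt hlt)
  · exact ((hle c).trans_eq hgc).lt_or_eq.imp_right fun h => ⟨h, hbc⟩

lemma measurableSet_isFirstMax {α : Type*} [MeasurableSpace α] [Countable κ] {g : α → κ → ℕ}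
    (hg : ∀ c, Measurable fun x => g x c) (b : κ) : MeasurableSet {x | IsFirstMax (g x) b} := by
  have hInter : {x | IsFirstMax (g x) b} =
      ⋂ c, ({x | g x c < g x b} ∪ ({x | g x c = g x b} ∩ {_x | b ≤ c})) := by
    ext x
    simp [IsFirstMax]
  rw [hInter]
  exact MeasurableSet.iInter fun c => (measurableSet_lt (hg c) (hg b)).union
    ((measurableSet_eq_fun (hg c) (hg b)).inter (MeasurableSet.const _))

end IsFirstMax

section Winner

variable (l : ℝ≥0)

/-- The event that `b` is the first of the alternatives for which the most agents have value at
least `l`, and that agent `i` is one of these agents. -/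
def winnerEvent (b : Fin m) (i : Fin n) : Set (Valuations n m) :=
  {v | IsFirstMax (fun c => countGE l fun j => v j c) b ∧ l ≤ v i b}

lemma measurableSet_le_apply (i : Fin n) (a : Fin m) :
    MeasurableSet {v : Valuations n m | l ≤ v i a} :=
  measurableSet_le measurable_const (by fun_prop)

lemma measurable_ind_le_apply (i : Fin n) (a : Fin m) :
    Measurable fun v : Valuations n m => ind (l ≤ v i a) :=
  measurable_ind (measurableSet_le_apply l i a)

lemma measurable_countGE_row (i : Fin n) :
    Measurable fun v : Valuations n m => countGE l (v i) :=
  (measurable_countGE l).comp (measurable_pi_apply i)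

lemma measurableSet_winnerEvent (b : Fin m) (i : Fin n) : MeasurableSet (winnerEvent l b i) :=
  (measurableSet_isFirstMax (fun c => (measurable_countGE l).comp (by fun_prop)) b).inter
    (measurableSet_le_apply l i b)

lemma update_mem_winnerEvent {l : ℝ≥0} {a b : Fin m} {i : Fin n} (hab : a ≠ b)
    {v : Valuations n m} (hv : v ∈ winnerEvent l b i) (hia : l ≤ v i a) (z : ℝ≥0) :
    Function.update v i (Function.update (v i) a z) ∈ winnerEvent l b i := by
  set w := Function.update v i (Function.update (v i) a z)
  have hne {c : Fin m} (hc : c ≠ a) (j : Fin n) : w j c = v j c := by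
    rcases eq_or_ne j i with rfl | hj
    · simp [w, hc]
    · simp [w, hj]
  refine ⟨hv.1.of_le ?_ fun c => countGE_mono l fun j hj => ?_, (hne hab.symm i).symm ▸ hv.2⟩
  · simp only [hne hab.symm]
  · rcases eq_or_ne c a with rfl | hc
    · rcases eq_or_ne j i with rfl | hji
      · exact hia
      · simpa [w, hji] using hj
    · rwa [← hne hc j]

lemma maxLoad_ind_le_sum_winnerEvent [NeZero m] (v : Valuations n m) :
    maxLoad (fun i a => ind (l ≤ v i a)) ≤ ∑ b, ∑ i, ind (v ∈ winnerEvent l b i) := by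
  obtain ⟨b, hb⟩ := exists_isFirstMax fun c : Fin m => countGE l fun i => v i c
  calc maxLoad (fun i a => ind (l ≤ v i a))
      ≤ ∑ i, ind (l ≤ v i b) := maxLoad_le fun a => by
        simpa only [← coe_countGE] using Nat.cast_le.2 (hb.le a)
    _ ≤ ∑ i, ind (v ∈ winnerEvent l b i) :=
        Finset.sum_le_sum fun i _ => ind_mono fun hi => ⟨hb, hi⟩
    _ ≤ ∑ b, ∑ i, ind (v ∈ winnerEvent l b i) :=
        Finset.single_le_sum (f := fun b => ∑ i, ind (v ∈ winnerEvent l b i))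
          (fun _ _ => zero_le) (Finset.mem_univ b)

lemma sum_winnerEvent_le_maxLoad [NeZero m] (v : Valuations n m) (T : Fin n → Prop) :
    ∑ b, ∑ i, ind (v ∈ winnerEvent l b i ∧ T i) ≤
      maxLoad fun i a => ind (l ≤ v i a ∧ T i) := by
  obtain ⟨b, hb⟩ := exists_isFirstMax fun c : Fin m => countGE l fun i => v i c
  rw [Fintype.sum_eq_single b fun c hc =>
    Finset.sum_eq_zero fun i _ => ind_of_not fun h => hc (h.1.1.eq hb)]
  exact (Finset.sum_le_sum fun i _ => ind_mono fun h => ⟨h.1.2, h.2⟩).trans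
    (le_maxLoad (fun i a => ind (l ≤ v i a ∧ T i)) b)

variable (F : Measure ℝ≥0) [IsProbabilityMeasure F]

lemma measure_winnerEvent_inter_le {a b : Fin m} (hab : a ≠ b) (i : Fin n) :
    valuationLaw n m F (winnerEvent l b i ∩ {v | l ≤ v i a}) ≤
      F (Set.Ici l) * valuationLaw n m F (winnerEvent l b i) :=
  measure_pi_pi_inter_le F i a (measurableSet_winnerEvent l b i) measurableSet_Ici
    fun _ hv hia => update_mem_winnerEvent hab hv hia

lemma setLIntegral_winnerEvent_countGE_le (b : Fin m) (i : Fin n) :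
    ∫⁻ v in winnerEvent l b i, countGE l (v i) ∂valuationLaw n m F ≤
      (1 + m * F (Set.Ici l)) * valuationLaw n m F (winnerEvent l b i) := by
  set ν := valuationLaw n m F
  have hterm (a : Fin m) : ∫⁻ v in winnerEvent l b i, ind (l ≤ v i a) ∂ν =
      ν (winnerEvent l b i ∩ {v | l ≤ v i a}) := by
    rw [Set.inter_comm, ← Measure.restrict_apply (measurableSet_le_apply l i a)]
    exact lintegral_ind _ (measurableSet_le_apply l i a)
  have hsingle : ∑ a : Fin m, ind (a = b) = 1 :=
    (Fintype.sum_eq_single b fun a h => ind_of_not h).trans (ind_of rfl)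
  simp only [coe_countGE]
  rw [lintegral_finsetSum _ fun a _ => measurable_ind_le_apply l i a]
  calc ∑ a, ∫⁻ v in winnerEvent l b i, ind (l ≤ v i a) ∂ν
      ≤ ∑ a, (ind (a = b) + F (Set.Ici l)) * ν (winnerEvent l b i) := by
        refine Finset.sum_le_sum fun a _ => ?_
        rw [hterm]
        rcases eq_or_ne a b with hab | hab
        · rw [ind_of hab, add_mul, one_mul]
          exact (measure_mono Set.inter_subset_left).trans le_self_add
        · rw [ind_of_not hab, zero_add]
          exact measure_winnerEvent_inter_le l F hab i
    _ = (1 + m * F (Set.Ici l)) * ν (winnerEvent l b i) := by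
        simp [← Finset.sum_mul, Finset.sum_add_distrib, hsingle]

variable {K : ℕ}

lemma measure_winnerEvent_le_truncated (hK : 2 * (1 + m * F (Set.Ici l)) ≤ K) (b : Fin m)
    (i : Fin n) : valuationLaw n m F (winnerEvent l b i) ≤
      2 * valuationLaw n m F {v | v ∈ winnerEvent l b i ∧ countGE l (v i) ≤ K} := by
  set ν := valuationLaw n m F
  have hK0 : (K : ℝ≥0∞) ≠ 0 := by
    rintro h
    simp [h] at hK
  have hcount : Measurable fun v : Valuations n m => (countGE l (v i) : ℝ≥0∞) :=
    measurable_from_top.comp (measurable_countGE_row l i)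
  have hmean : 2 * ∫⁻ v in winnerEvent l b i, countGE l (v i) ∂ν ≤ K * ν (winnerEvent l b i) :=
    calc 2 * ∫⁻ v in winnerEvent l b i, countGE l (v i) ∂ν
        ≤ 2 * ((1 + m * F (Set.Ici l)) * ν (winnerEvent l b i)) := by
          gcongr
          exact setLIntegral_winnerEvent_countGE_le l F b i
      _ ≤ K * ν (winnerEvent l b i) := by
          rw [← mul_assoc]
          gcongr
  simpa only [Nat.cast_le, Set.inter_def, Set.mem_ofPred_eq] using
    measure_le_two_mul_measure_inter_le (measure_ne_top ν _) hcount hK0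
      (ENNReal.natCast_ne_top K) hmean

lemma lintegral_maxLoad_le_truncated [NeZero m] (hK : 2 * (1 + m * F (Set.Ici l)) ≤ K) :
    ∫⁻ v : Valuations n m, maxLoad (fun i a => ind (l ≤ v i a)) ∂valuationLaw n m F ≤
      2 * ∫⁻ v : Valuations n m, maxLoad (fun i a => ind (l ≤ v i a ∧ countGE l (v i) ≤ K))
        ∂valuationLaw n m F := by
  set ν := valuationLaw n m F
  have hmeas (b : Fin m) (i : Fin n) := measurableSet_winnerEvent l b i
  have hmeasK (b : Fin m) (i : Fin n) :
      MeasurableSet {v : Valuations n m | v ∈ winnerEvent l b i ∧ countGE l (v i) ≤ K} :=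
    (hmeas b i).inter (measurableSet_le (measurable_countGE_row l i) measurable_const)
  calc ∫⁻ v, maxLoad (fun i a => ind (l ≤ v i a)) ∂ν
      ≤ ∫⁻ v, ∑ b, ∑ i, ind (v ∈ winnerEvent l b i) ∂ν :=
        lintegral_mono (maxLoad_ind_le_sum_winnerEvent l)
    _ = ∑ b, ∑ i, ν (winnerEvent l b i) := lintegral_sum_sum_ind hmeas
    _ ≤ ∑ b, ∑ i, 2 * ν {v | v ∈ winnerEvent l b i ∧ countGE l (v i) ≤ K} :=
        Finset.sum_le_sum fun b _ => Finset.sum_le_sum fun i _ =>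
          measure_winnerEvent_le_truncated l F hK b i
    _ = 2 * ∫⁻ v, ∑ b, ∑ i, ind (v ∈ winnerEvent l b i ∧ countGE l (v i) ≤ K) ∂ν := by
        simp only [← Finset.mul_sum]
        exact congrArg (2 * ·) (lintegral_sum_sum_ind hmeasK).symm
    _ ≤ 2 * ∫⁻ v, maxLoad (fun i a => ind (l ≤ v i a ∧ countGE l (v i) ≤ K)) ∂ν := by
        gcongr with v
        exact sum_winnerEvent_le_maxLoad l v _

end Winner

/-! ### Covering the approved places by cyclic shifts -/

lemma one_le_queryPos (m : ℕ) (p : ℝ) : 1 ≤ queryPos m p := le_max_left _ _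

lemma queryPos_le [NeZero m] {p : ℝ} (hp : p ≤ 1) : queryPos m p ≤ m :=
  max_le NeZero.one_le (Nat.floor_le_of_le (mul_le_of_le_one_left (Nat.cast_nonneg m) hp))

lemma two_mul_one_add_le_queryPos (F : Measure ℝ≥0) [IsFiniteMeasure F] (m : ℕ) (l : ℝ≥0) :
    2 * (1 + m * F (Set.Ici l)) ≤ ((6 * queryPos m (tailProb F l) : ℕ) : ℝ≥0∞) := by
  set τ := queryPos m (tailProb F l)
  have hmean : tailProb F l * m < τ + 1 := (Nat.lt_floor_add_one _).trans_le <| by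
    gcongr
    exact le_max_right _ _
  have hτ : (1 : ℝ) ≤ τ := Nat.one_le_cast.2 (one_le_queryPos _ _)
  have hp : 0 ≤ tailProb F l := measureReal_nonneg
  calc 2 * (1 + m * F (Set.Ici l))
      = ENNReal.ofReal (2 * (1 + m * tailProb F l)) := by
        rw [ENNReal.ofReal_mul zero_le_two, ENNReal.ofReal_add zero_le_one (by positivity),
          ENNReal.ofReal_mul (Nat.cast_nonneg m), tailProb, ofReal_measureReal]
        simp
    _ ≤ ENNReal.ofReal ((6 * τ : ℕ) : ℝ) := by
        refine ENNReal.ofReal_le_ofReal ?_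
        push_cast
        linarith
    _ = ((6 * τ : ℕ) : ℝ≥0∞) := ENNReal.ofReal_natCast _

lemma exists_shift_cover (m j : ℕ) [NeZero m] {τ : ℕ} (hτ : 1 ≤ τ) :
    ∃ c : Fin j → Equiv.Perm (Fin m), ∀ (x : Fin m) (k : ℕ), (x : ℕ) < k → k ≤ j * τ →
      ∃ t, (c t x : ℕ) < τ := by
  refine ⟨fun t => Equiv.subRight (Fin.ofNat m (t * τ)), fun x k hxk hk => ?_⟩
  refine ⟨⟨x / τ, (Nat.div_lt_iff_lt_mul hτ).2 (hxk.trans_le hk)⟩, ?_⟩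
  have hle : (x : ℕ) / τ * τ ≤ x := Nat.div_mul_le_self _ _
  have hval : ((Fin.ofNat m ((x : ℕ) / τ * τ) : Fin m) : ℕ) = (x : ℕ) / τ * τ :=
    Nat.mod_eq_of_lt (hle.trans_lt x.isLt)
  rw [Equiv.subRight_apply, Fin.sub_val_of_le (Fin.le_def.2 (hval.trans_le hle)), hval,
    ← Nat.mod_eq_sub_div_mul]
  exact Nat.mod_lt _ hτ

lemma avg_maxLoad_ind_lt_le [NeZero m] (k : Fin n → ℕ) {τ : ℕ} (hτ : 1 ≤ τ) (j : ℕ) :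
    avg Finset.univ (fun P : Profile n m =>
        maxLoad fun i a => ind ((P i a : ℕ) < k i ∧ k i ≤ j * τ)) ≤
      j * avg Finset.univ fun P : Profile n m =>
        maxLoad fun i a => ind (1 ≤ k i ∧ (P i a : ℕ) < τ) := by
  obtain ⟨c, hc⟩ := exists_shift_cover m j hτ
  set f : Profile n m → ℝ≥0∞ := fun P => maxLoad fun i a => ind (1 ≤ k i ∧ (P i a : ℕ) < τ)
  have hcover (P : Profile n m) :
      maxLoad (fun i a => ind ((P i a : ℕ) < k i ∧ k i ≤ j * τ)) ≤
        ∑ t, f (Equiv.mulLeft (fun _ => c t) P) := by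
    refine (maxLoad_mono fun i a => ind_le fun h => ?_).trans (maxLoad_sum_le Finset.univ
      fun t i a => ind (1 ≤ k i ∧ (c t (P i a) : ℕ) < τ))
    obtain ⟨t, ht⟩ := hc (P i a) (k i) h.1 h.2
    exact (ind_of ⟨Nat.one_le_of_lt h.1, ht⟩).symm.trans_le
      (Finset.single_le_sum (f := fun t => ind (1 ≤ k i ∧ (c t (P i a) : ℕ) < τ))
        (fun _ _ => zero_le) (Finset.mem_univ t))
  refine (avg_mono fun P _ => hcover P).trans_eq ?_
  rw [avg_sum]
  simp only [avg_univ_comp_equiv, Finset.sum_const, Finset.card_univ, Fintype.card_fin,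
    nsmul_eq_mul]

section BinaryWelfare

variable (l : ℝ≥0)

/-- The maximum implied welfare when position `τ` is queried and the answers are binarized at the
threshold `l`: by consistency, agent `i` answers `1` if and only if at least `τ` of her values are
at least `l`. -/
def maxImpliedWelfare (τ : ℕ) (v : Valuations n m) (P : Profile n m) : ℝ≥0∞ :=
  maxLoad fun i a => ind (τ ≤ countGE l (v i) ∧ (P i a : ℕ) < τ)

lemma measurable_ind_countGE_row (i : Fin n) (T : ℕ → Prop) :
    Measurable fun v : Valuations n m => ind (T (countGE l (v i))) :=
  (measurable_from_top (f := fun k => ind (T k))).comp (measurable_countGE_row l i)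

lemma measurable_maxImpliedWelfare (τ : ℕ) (P : Profile n m) :
    Measurable fun v : Valuations n m => maxImpliedWelfare l τ v P :=
  measurable_maxLoad fun i a => measurable_ind_countGE_row l i fun k => τ ≤ k ∧ (P i a : ℕ) < τ

variable (F : Measure ℝ≥0) [IsProbabilityMeasure F]

lemma lintegral_avg_maxLoad_ind_countGE (T : ℕ → Fin m → Prop) :
    ∫⁻ v : Valuations n m, avg (consistentProfiles v) (fun P : Profile n m =>
        maxLoad fun i a => ind (T (countGE l (v i)) (P i a))) ∂valuationLaw n m F =
      ∫⁻ v : Valuations n m, avg Finset.univ (fun P : Profile n m =>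
        maxLoad fun i a => ind (T (countGE l (v i)) (P i a))) ∂valuationLaw n m F := by
  refine lintegral_avg_consistentProfiles F (fun P => measurable_maxLoad fun i a =>
    measurable_ind_countGE_row l i fun k => T k (P i a)) fun v Q => ?_
  simp only [permute, countGE_comp_perm]

lemma two_le_mul_measure_floor_le_countGE (i : Fin n) :
    2 ≤ 25 * valuationLaw n m F {v | ⌊tailProb F l * m⌋₊ ≤ countGE l (v i)} := by
  have hrow : valuationLaw n m F {v | ⌊tailProb F l * m⌋₊ ≤ countGE l (v i)} =
      Measure.pi (fun _ : Fin m => F) {u | ⌊tailProb F l * m⌋₊ ≤ countGE l u} :=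
    (measurePreserving_eval (fun _ : Fin n => Measure.pi fun _ : Fin m => F) i).measure_preimage
      (measurableSet_le measurable_const (measurable_countGE l)).nullMeasurableSet
  rw [hrow]
  set ρ := Measure.pi fun _ : Fin m => F
  set A := {u : Fin m → ℝ≥0 | ⌊tailProb F l * m⌋₊ ≤ countGE l u}
  have hreal : 2 / 25 ≤ ρ.real A := by
    have hcard := le_measureReal_floor_le_card (ι := Fin m) F (measurableSet_Ici (a := l))
    rwa [Fintype.card_fin] at hcard
  calc (2 : ℝ≥0∞) = ENNReal.ofReal 2 := by simp
    _ ≤ ENNReal.ofReal (25 * ρ.real A) := ENNReal.ofReal_le_ofReal (by linarith)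
    _ = 25 * ρ A := by
        rw [ENNReal.ofReal_mul (by norm_num), ofReal_measureReal]
        norm_num

lemma two_mul_lintegral_le_maxImpliedWelfare (P : Profile n m) :
    2 * ∫⁻ v : Valuations n m,
        maxLoad (fun i a => ind (1 ≤ countGE l (v i) ∧ (P i a : ℕ) < queryPos m (tailProb F l)))
        ∂valuationLaw n m F ≤
      25 * ∫⁻ v, maxImpliedWelfare l (queryPos m (tailProb F l)) v P ∂valuationLaw n m F := by
  set ν := valuationLaw n m F
  rcases le_total ⌊tailProb F l * m⌋₊ 1 with hfloor | hfloor
  · rw [queryPos, max_eq_left hfloor]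
    gcongr
    · norm_num
    · exact le_rfl
  rw [queryPos, max_eq_right hfloor]
  set τ := ⌊tailProb F l * m⌋₊
  have hprob (i : Fin n) (a : Fin m) : 2 * ind ((P i a : ℕ) < τ) ≤
      25 * ∫⁻ v, ind (τ ≤ countGE l (v i) ∧ (P i a : ℕ) < τ) ∂ν := by
    by_cases ha : (P i a : ℕ) < τ
    · simp only [ha, and_true, ind_of, mul_one]
      have hind := lintegral_ind ν (s := {v | τ ≤ countGE l (v i)})
        (measurableSet_le measurable_const (measurable_countGE_row l i))
      exact (two_le_mul_measure_floor_le_countGE l F i).trans_eq (congrArg (25 * ·) hind.symm)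
    · simp [ind_of_not ha]
  calc 2 * ∫⁻ v, maxLoad (fun i a => ind (1 ≤ countGE l (v i) ∧ (P i a : ℕ) < τ)) ∂ν
      ≤ 2 * ∫⁻ _, maxLoad (fun i a => ind ((P i a : ℕ) < τ)) ∂ν := by
        gcongr with v
        exact maxLoad_mono fun i a => ind_mono And.right
    _ = maxLoad fun i a => 2 * ind ((P i a : ℕ) < τ) := by
        rw [lintegral_const, measure_univ, mul_one, maxLoad_const_mul]
    _ ≤ maxLoad fun i a => 25 * ∫⁻ v, ind (τ ≤ countGE l (v i) ∧ (P i a : ℕ) < τ) ∂ν :=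
        maxLoad_mono hprob
    _ ≤ 25 * ∫⁻ v, maxImpliedWelfare l τ v P ∂ν := by
        rw [maxLoad_const_mul]
        gcongr
        exact maxLoad_lintegral_le fun i a =>
          measurable_ind_countGE_row l i fun k => τ ≤ k ∧ (P i a : ℕ) < τ

lemma lintegral_maxLoad_le_maxImpliedWelfare [NeZero m] :
    ∫⁻ v : Valuations n m, maxLoad (fun i a => ind (l ≤ v i a)) ∂valuationLaw n m F ≤
      150 * ∫⁻ v : Valuations n m,
        avg (consistentProfiles v) (maxImpliedWelfare l (queryPos m (tailProb F l)) v)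
        ∂valuationLaw n m F := by
  set ν := valuationLaw n m F
  set τ := queryPos m (tailProb F l)
  have hτ : 1 ≤ τ := one_le_queryPos _ _
  have hranked (v : Valuations n m) :
      maxLoad (fun i a => ind (l ≤ v i a ∧ countGE l (v i) ≤ 6 * τ)) =
        avg (consistentProfiles v) fun P => maxLoad fun i a =>
          ind ((P i a : ℕ) < countGE l (v i) ∧ countGE l (v i) ≤ 6 * τ) := by
    refine (avg_const (consistentProfiles_nonempty v) _).symm.trans (avg_congr fun P hP => ?_)
    simp only [(mem_consistentProfiles.1 hP _).le_iff]
  have hmeas (P : Profile n m) : Measurable fun v : Valuations n m =>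
      maxLoad fun i a => ind (1 ≤ countGE l (v i) ∧ (P i a : ℕ) < τ) :=
    measurable_maxLoad fun i a => measurable_ind_countGE_row l i fun k => 1 ≤ k ∧ (P i a : ℕ) < τ
  calc ∫⁻ v, maxLoad (fun i a => ind (l ≤ v i a)) ∂ν
      ≤ 2 * ∫⁻ v, maxLoad (fun i a => ind (l ≤ v i a ∧ countGE l (v i) ≤ 6 * τ)) ∂ν :=
        lintegral_maxLoad_le_truncated l F (two_mul_one_add_le_queryPos F m l)
    _ = 2 * ∫⁻ v, avg Finset.univ (fun P : Profile n m => maxLoad fun i a =>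
          ind ((P i a : ℕ) < countGE l (v i) ∧ countGE l (v i) ≤ 6 * τ)) ∂ν := by
        simp only [hranked]
        rw [lintegral_avg_maxLoad_ind_countGE l F fun k x => (x : ℕ) < k ∧ k ≤ 6 * τ]
    _ ≤ 2 * ∫⁻ v, 6 * avg Finset.univ (fun P : Profile n m => maxLoad fun i a =>
          ind (1 ≤ countGE l (v i) ∧ (P i a : ℕ) < τ)) ∂ν := by
        gcongr with v
        exact avg_maxLoad_ind_lt_le (fun i => countGE l (v i)) hτ 6
    _ = 6 * avg Finset.univ fun P : Profile n m => 2 * ∫⁻ v, maxLoad (fun i a =>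
          ind (1 ≤ countGE l (v i) ∧ (P i a : ℕ) < τ)) ∂ν := by
        rw [lintegral_const_mul' _ _ (by simp), lintegral_avg ν _ hmeas, avg_const_mul,
          mul_left_comm]
    _ ≤ 6 * avg Finset.univ fun P => 25 * ∫⁻ v, maxImpliedWelfare l τ v P ∂ν := by
        gcongr
        exact avg_mono fun P _ => two_mul_lintegral_le_maxImpliedWelfare l F P
    _ = 150 * ∫⁻ v, avg Finset.univ (maxImpliedWelfare l τ v) ∂ν := by
        rw [avg_const_mul, lintegral_avg ν _ (measurable_maxImpliedWelfare l τ), ← mul_assoc]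
        norm_num
    _ = 150 * ∫⁻ v, avg (consistentProfiles v) (maxImpliedWelfare l τ v) ∂ν :=
        congrArg (150 * ·)
          (lintegral_avg_maxLoad_ind_countGE l F fun k x => τ ≤ k ∧ (x : ℕ) < τ).symm

end BinaryWelfare

/-! ### The welfare achieved by RtMean -/

section Mechanism

lemma binarize_answers_eq_one_iff [NeZero m] (l : ℝ≥0) {P : Profile n m} {v : Valuations n m}
    (hP : P ∈ consistentProfiles v) {τ : ℕ} (hτ : 1 ≤ τ) (hτm : τ ≤ m) (i : Fin n) :
    binarize l (answers P v τ i) = 1 ↔ τ ≤ countGE l (v i) := by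
  have hplace : (P i (altAt (P i) τ) : ℕ) = τ - 1 := by
    rw [altAt, Equiv.apply_symm_apply, Fin.val_ofNat, Nat.mod_eq_of_lt (by omega)]
  have hcount : binarize l (answers P v τ i) = 1 ↔ l ≤ v i (altAt (P i) τ) := by
    by_cases h : l ≤ v i (altAt (P i) τ) <;> simp [binarize, answers, h]
  rw [hcount, (mem_consistentProfiles.1 hP i).le_iff, hplace]
  omega

lemma coe_impliedWelfare_binarize [NeZero m] (l : ℝ≥0) {P : Profile n m} {v : Valuations n m}
    (hP : P ∈ consistentProfiles v) {τ : ℕ} (hτ : 1 ≤ τ) (hτm : τ ≤ m) (a : Fin m) :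
    (impliedWelfare a P (fun i => binarize l (answers P v τ i)) τ : ℝ≥0∞) =
      ∑ i, ind (τ ≤ countGE l (v i) ∧ (P i a : ℕ) < τ) := by
  simp only [impliedWelfare, Nat.cast_sum, Nat.cast_ite, Nat.cast_one, Nat.cast_zero]
  refine Finset.sum_congr rfl fun i _ => ?_
  simp only [binarize_answers_eq_one_iff l hP hτ hτm, pos, Nat.succ_le_iff, ind]
  congr

lemma mul_sum_ind_le_socialWelfare (l : ℝ≥0) {P : Profile n m} {v : Valuations n m}
    (hP : P ∈ consistentProfiles v) (τ : ℕ) (a : Fin m) :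
    l * ∑ i, ind (τ ≤ countGE l (v i) ∧ (P i a : ℕ) < τ) ≤ socialWelfare a v := by
  rw [Finset.mul_sum, socialWelfare, ENNReal.ofNNReal_finsetSum]
  refine Finset.sum_le_sum fun i _ => ?_
  by_cases h : τ ≤ countGE l (v i) ∧ (P i a : ℕ) < τ
  · rw [ind_of h, mul_one]
    exact ENNReal.coe_le_coe.2
      (((mem_consistentProfiles.1 hP i).le_iff l a).2 (h.2.trans_le h.1))
  · rw [ind_of_not h, mul_zero]
    exact zero_le

lemma mul_maxImpliedWelfare_le_socialWelfare [NeZero m] (l : ℝ≥0) {p : ℝ} (hp : p ≤ 1)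
    {S : Profile n m → (Fin n → ℝ≥0) → Fin m} (hS : IsMeanRule p S) {v : Valuations n m}
    {P : Profile n m} (hP : P ∈ consistentProfiles v) :
    l * maxImpliedWelfare l (queryPos m p) v P ≤
      socialWelfare (S P fun i => binarize l (answers P v (queryPos m p) i)) v := by
  refine le_trans ?_ (mul_sum_ind_le_socialWelfare l hP (queryPos m p) _)
  gcongr
  refine maxLoad_le fun a => ?_
  simp only [← coe_impliedWelfare_binarize l hP (one_le_queryPos m p) (queryPos_le hp)]
  exact Nat.cast_le.2 (hS P _ a)

lemma winnerWelfare_rtMean {k : ℕ} [NeZero m] [NeZero k] (F : Measure ℝ≥0) (l : Fin k → ℝ≥0)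
    (S : Fin k → Profile n m → (Fin n → ℝ≥0) → Fin m) (P : Profile n m) (v : Valuations n m) :
    winnerWelfare (rtMean F l S) P v =
      (k : ℝ≥0∞)⁻¹ * ∑ t, (socialWelfare (S t P fun i =>
        binarize (l t) (answers P v (queryPos m (tailProb F (l t))) i)) v : ℝ≥0∞) := by
  simp only [winnerWelfare, rtMean, PMF.map_apply, tsum_fintype, Finset.sum_mul,
    PMF.uniformOfFintype_apply, Fintype.card_fin]
  rw [Finset.sum_comm, Finset.mul_sum]
  refine Finset.sum_congr rfl fun t _ => ?_
  simp only [ite_mul, zero_mul, Finset.sum_ite_eq', Finset.mem_univ, if_true]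

lemma le_expectedWelfare_rtMean {k : ℕ} [NeZero m] [NeZero k] (F : Measure ℝ≥0)
    [IsProbabilityMeasure F] (l : Fin k → ℝ≥0) {S : Fin k → Profile n m → (Fin n → ℝ≥0) → Fin m}
    (hS : ∀ t, IsMeanRule (tailProb F (l t)) (S t)) :
    (k : ℝ≥0∞)⁻¹ * ∑ t, l t * ∫⁻ v : Valuations n m, avg (consistentProfiles v)
      (maxImpliedWelfare (l t) (queryPos m (tailProb F (l t))) v) ∂valuationLaw n m F ≤
    expectedWelfare (rtMean F l S) F := by
  have hmeas (t : Fin k) : Measurable fun v : Valuations n m => avg (consistentProfiles v)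
      (maxImpliedWelfare (l t) (queryPos m (tailProb F (l t))) v) :=
    measurable_avg measurableSet_mem_consistentProfiles (measurable_maxImpliedWelfare _ _)
  simp only [← lintegral_const_mul _ (hmeas _)]
  rw [← lintegral_finsetSum _ fun t _ => (hmeas t).const_mul _, ← lintegral_const_mul _
    (Finset.measurable_sum _ fun t _ => (hmeas t).const_mul _)]
  refine lintegral_mono fun v => ?_
  simp only [← avg_const_mul, ← avg_sum]
  refine avg_mono fun P hP => ?_
  rw [winnerWelfare_rtMean]
  gcongr with t
  exact mul_maxImpliedWelfare_le_socialWelfare (l t) measureReal_le_one (hS t) hP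

end Mechanism

/-! ### Dyadic thresholds -/

lemma le_dyadic_of_lt {c z : ℝ≥0} (k : ℕ) (h : z < c * 2 ^ k) :
    (z : ℝ≥0∞) ≤ c + 2 * ∑ t : Fin k, ((c * 2 ^ (t : ℕ) : ℝ≥0) : ℝ≥0∞) *
      ind (c * 2 ^ (t : ℕ) ≤ z) := by
  induction k with
  | zero => simpa using h.le
  | succ k ih =>
    rw [Fin.sum_univ_castSucc]
    simp only [Fin.val_castSucc, Fin.val_last]
    by_cases hz : c * 2 ^ k ≤ z
    · have hdouble : z ≤ 2 * (c * 2 ^ k) := h.le.trans_eq (by ring)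
      rw [ind_of hz, mul_one, mul_add]
      exact le_add_left (le_add_left (mod_cast hdouble))
    · refine (ih (not_le.1 hz)).trans ?_
      gcongr
      exact le_self_add

lemma le_dyadic (c z : ℝ≥0) (k : ℕ) :
    (z : ℝ≥0∞) ≤ c + 2 * ∑ t : Fin k, ((c * 2 ^ (t : ℕ) : ℝ≥0) : ℝ≥0∞) *
      ind (c * 2 ^ (t : ℕ) ≤ z) + z * ind (c * 2 ^ k ≤ z) := by
  by_cases hz : c * 2 ^ k ≤ z
  · rw [ind_of hz, mul_one]
    exact le_add_self
  · exact le_add_right (le_dyadic_of_lt k (not_le.1 hz))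

lemma strictMono_mul_two_pow {c : ℝ≥0} (hc : 0 < c) (k : ℕ) :
    StrictMono fun t : Fin k => c * 2 ^ (t : ℕ) := fun _ _ hst =>
  mul_lt_mul_of_pos_left (pow_lt_pow_right₀ one_lt_two hst) hc

lemma coe_maxWelfare (v : Valuations n m) :
    (maxWelfare v : ℝ≥0∞) = maxLoad fun i a => (v i a : ℝ≥0∞) := by
  simp only [maxWelfare, socialWelfare, maxLoad, ENNReal.coe_finset_sup, Finset.sup_univ_eq_iSup,
    ENNReal.ofNNReal_finsetSum]

lemma maxWelfare_le_dyadic (c : ℝ≥0) (k : ℕ) (v : Valuations n m) :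
    (maxWelfare v : ℝ≥0∞) ≤ n * c +
      2 * ∑ t : Fin k, ((c * 2 ^ (t : ℕ) : ℝ≥0) : ℝ≥0∞) *
        maxLoad (fun i a => ind (c * 2 ^ (t : ℕ) ≤ v i a)) +
      ∑ a, ∑ i, v i a * ind (c * 2 ^ k ≤ v i a) := by
  rw [coe_maxWelfare]
  refine (maxLoad_mono fun i a => le_dyadic c (v i a) k).trans <|
    (maxLoad_add_le _ _).trans <|
      add_le_add ((maxLoad_add_le _ _).trans (add_le_add ?_ ?_)) (maxLoad_le_sum _)
  · exact maxLoad_le fun _ => by simp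
  · rw [maxLoad_const_mul]
    gcongr
    refine (maxLoad_sum_le _ fun t i a => _).trans_eq ?_
    simp only [maxLoad_const_mul]

section Expectation

variable (F : Measure ℝ≥0) [IsProbabilityMeasure F]

lemma lintegral_eval_eval (i : Fin n) (a : Fin m) {g : ℝ≥0 → ℝ≥0∞} (hg : Measurable g) :
    ∫⁻ v, g (v i a) ∂valuationLaw n m F = ∫⁻ z, g z ∂F :=
  ((measurePreserving_eval (fun _ : Fin m => F) a).comp (measurePreserving_eval
    (fun _ : Fin n => Measure.pi fun _ : Fin m => F) i)).lintegral_comp hg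

lemma lintegral_sum_sum_eval {g : ℝ≥0 → ℝ≥0∞} (hg : Measurable g) :
    ∫⁻ v : Valuations n m, ∑ a, ∑ i, g (v i a) ∂valuationLaw n m F =
      n * (m * ∫⁻ z, g z ∂F) := by
  have hmeas (i : Fin n) (a : Fin m) : Measurable fun v : Valuations n m => g (v i a) := by
    fun_prop
  rw [lintegral_finsetSum _ fun a _ => Finset.measurable_sum _ fun i _ => hmeas i a]
  simp only [lintegral_finsetSum _ fun i _ => hmeas i _, lintegral_eval_eval F _ _ hg,
    Finset.sum_const, Finset.card_univ, Fintype.card_fin, nsmul_eq_mul]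
  ring

lemma mul_lintegral_le_expectedMaxWelfare (n m : ℕ) [NeZero m] :
    n * ∫⁻ z, (z : ℝ≥0∞) ∂F ≤ expectedMaxWelfare n m F := by
  calc n * ∫⁻ z, (z : ℝ≥0∞) ∂F
      = ∑ i : Fin n, ∫⁻ v : Valuations n m, (v i 0 : ℝ≥0∞) ∂valuationLaw n m F := by
        simp [fun i => lintegral_eval_eval F i (0 : Fin m) measurable_coe_nnreal_ennreal (n := n)]
    _ = ∫⁻ v : Valuations n m, ∑ i, (v i 0 : ℝ≥0∞) ∂valuationLaw n m F :=
        (lintegral_finsetSum _ fun i _ => by fun_prop).symm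
    _ ≤ expectedMaxWelfare n m F := lintegral_mono fun v =>
        (le_maxLoad (fun i a => (v i a : ℝ≥0∞)) 0).trans_eq (coe_maxWelfare v).symm

lemma expectedMaxWelfare_le_dyadic (n m k : ℕ) (c : ℝ≥0) :
    expectedMaxWelfare n m F ≤ n * c +
      2 * ∑ t : Fin k, ((c * 2 ^ (t : ℕ) : ℝ≥0) : ℝ≥0∞) * ∫⁻ v : Valuations n m,
        maxLoad (fun i a => ind (c * 2 ^ (t : ℕ) ≤ v i a)) ∂valuationLaw n m F +
      n * (m * ∫⁻ z, z * ind (c * 2 ^ k ≤ z) ∂F) := by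
  have htail : Measurable fun z : ℝ≥0 => (z : ℝ≥0∞) * ind (c * 2 ^ k ≤ z) :=
    measurable_coe_nnreal_ennreal.mul (measurable_ind measurableSet_Ici)
  have hload (t : Fin k) : Measurable fun v : Valuations n m =>
      maxLoad (fun i a => ind (c * 2 ^ (t : ℕ) ≤ v i a)) :=
    measurable_maxLoad fun i a => measurable_ind_le_apply _ i a
  have hsum := Finset.measurable_sum Finset.univ fun t (_ : t ∈ Finset.univ) =>
    (hload t).const_mul ((c * 2 ^ (t : ℕ) : ℝ≥0) : ℝ≥0∞)
  refine (lintegral_mono fun v => maxWelfare_le_dyadic c k v).trans_eq ?_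
  rw [lintegral_add_left (measurable_const.fun_add (hsum.const_mul 2)),
    lintegral_add_left measurable_const, lintegral_const, measure_univ, mul_one,
    lintegral_const_mul _ hsum, lintegral_finsetSum _ fun t _ => (hload t).const_mul _,
    lintegral_sum_sum_eval F htail]
  simp only [lintegral_const_mul _ (hload _)]

variable {F}

lemma expectedMaxWelfare_le_four_mul_sum (n : ℕ) [NeZero m] {k : ℕ} {c : ℝ≥0}
    (hmean : 4 * c ≤ ∫⁻ z, (z : ℝ≥0∞) ∂F) (htail : m * ∫⁻ z, z * ind (c * 2 ^ k ≤ z) ∂F ≤ c) :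
    expectedMaxWelfare n m F ≤
      4 * ∑ t : Fin k, ((c * 2 ^ (t : ℕ) : ℝ≥0) : ℝ≥0∞) * ∫⁻ v : Valuations n m,
        maxLoad (fun i a => ind (c * 2 ^ (t : ℕ) ≤ v i a)) ∂valuationLaw n m F := by
  set X := ∑ t : Fin k, ((c * 2 ^ (t : ℕ) : ℝ≥0) : ℝ≥0∞) * ∫⁻ v : Valuations n m,
    maxLoad (fun i a => ind (c * 2 ^ (t : ℕ) ≤ v i a)) ∂valuationLaw n m F
  set b : ℝ≥0∞ := 2 * (n * c)
  have hupper : expectedMaxWelfare n m F ≤ b + 2 * X := by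
    calc expectedMaxWelfare n m F
        ≤ n * c + 2 * X + n * (m * ∫⁻ z, z * ind (c * 2 ^ k ≤ z) ∂F) :=
          expectedMaxWelfare_le_dyadic F n m k c
      _ ≤ n * c + 2 * X + n * c := by gcongr
      _ = b + 2 * X := by ring
  have hlower : b + b ≤ expectedMaxWelfare n m F := by
    calc b + b = n * (4 * c) := by ring
      _ ≤ n * ∫⁻ z, (z : ℝ≥0∞) ∂F := by gcongr
      _ ≤ expectedMaxWelfare n m F := mul_lintegral_le_expectedMaxWelfare F n m
  have hb : b ≠ ∞ := by finiteness
  have hbX : b ≤ 2 * X := (ENNReal.add_le_add_iff_left hb).1 (hlower.trans hupper)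
  calc expectedMaxWelfare n m F ≤ 2 * X + 2 * X := hupper.trans (by gcongr)
    _ = 4 * X := by ring

lemma avgDistortion_rtMean_le [NeZero m] {k : ℕ} [NeZero k] {c : ℝ≥0}
    (hmean : 4 * c ≤ ∫⁻ z, (z : ℝ≥0∞) ∂F) (htail : m * ∫⁻ z, z * ind (c * 2 ^ k ≤ z) ∂F ≤ c)
    {S : Fin k → Profile n m → (Fin n → ℝ≥0) → Fin m}
    (hS : ∀ t : Fin k, IsMeanRule (tailProb F (c * 2 ^ (t : ℕ))) (S t)) :
    avgDistortion (rtMean F (fun t => c * 2 ^ (t : ℕ)) S) F ≤ 600 * k := by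
  set l : Fin k → ℝ≥0 := fun t => c * 2 ^ (t : ℕ)
  set W : Fin k → ℝ≥0∞ := fun t => ∫⁻ v : Valuations n m, avg (consistentProfiles v)
    (maxImpliedWelfare (l t) (queryPos m (tailProb F (l t))) v) ∂valuationLaw n m F
  have hk : (k : ℝ≥0∞) ≠ 0 := Nat.cast_ne_zero.2 (NeZero.ne k)
  refine ENNReal.div_le_of_le_mul ?_
  calc expectedMaxWelfare n m F
      ≤ 4 * ∑ t, l t * ∫⁻ v : Valuations n m, maxLoad (fun i a => ind (l t ≤ v i a))
          ∂valuationLaw n m F := expectedMaxWelfare_le_four_mul_sum n hmean htail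
    _ ≤ 4 * ∑ t, l t * (150 * W t) := by
        gcongr with t
        exact lintegral_maxLoad_le_maxImpliedWelfare (l t) F
    _ = 600 * ∑ t, l t * W t := by
        simp only [mul_left_comm _ (150 : ℝ≥0∞)]
        rw [← Finset.mul_sum, ← mul_assoc]
        norm_num
    _ = 600 * k * ((k : ℝ≥0∞)⁻¹ * ∑ t, l t * W t) := by
        rw [mul_assoc, ← mul_assoc (k : ℝ≥0∞), ENNReal.mul_inv_cancel hk (by simp), one_mul]
    _ ≤ 600 * k * expectedWelfare (rtMean F l S) F := by
        gcongr
        exact le_expectedWelfare_rtMean F l hS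

end Expectation

/-! ### The second moment and the number of thresholds -/

section SecondMoment

variable {F : Measure ℝ≥0} {μ σ : ℝ}

lemma lintegral_coe_eq_ofReal_integral (hF : Integrable (fun z : ℝ≥0 => (z : ℝ)) F) :
    ∫⁻ z, (z : ℝ≥0∞) ∂F = ENNReal.ofReal (∫ z, (z : ℝ) ∂F) := by
  rw [ofReal_integral_eq_lintegral_ofReal hF (ae_of_all _ fun z => z.coe_nonneg)]
  simp only [ENNReal.ofReal_coe_nnreal]

lemma lintegral_tail_le [IsFiniteMeasure F] (hF : MemLp (fun z : ℝ≥0 => (z : ℝ)) 2 F)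
    {L : ℝ≥0} (hL : 0 < L) (hmean : 2 * ∫ z, (z : ℝ) ∂F ≤ L) :
    ∫⁻ z, z * ind (L ≤ z) ∂F ≤ ENNReal.ofReal (4 / L * Var[fun z : ℝ≥0 => (z : ℝ); F]) := by
  set μ := ∫ z, (z : ℝ) ∂F
  have hpos : (0 : ℝ) < L := NNReal.coe_pos.2 hL
  rw [ENNReal.ofReal_mul (by positivity), hF.ofReal_variance_eq, evariance,
    ← lintegral_const_mul' _ _ ENNReal.ofReal_ne_top]
  refine lintegral_mono fun z => ?_
  by_cases hz : L ≤ z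
  · have hzL : (L : ℝ) ≤ z := NNReal.coe_le_coe.2 hz
    have hdev : ((z : ℝ) / 2) ^ 2 ≤ (z - μ) ^ 2 :=
      pow_le_pow_left₀ (by positivity) (by linarith) 2
    rw [ind_of hz, mul_one, Real.enorm_eq_ofReal_abs, ← ENNReal.ofReal_pow (abs_nonneg _), sq_abs,
      ← ENNReal.ofReal_mul (by positivity), ← ENNReal.ofReal_coe_nnreal]
    refine ENNReal.ofReal_le_ofReal ?_
    rw [div_mul_eq_mul_div, le_div_iff₀ hpos]
    nlinarith [hzL]
  · rw [ind_of_not hz, mul_zero]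
    exact zero_le

lemma mul_lintegral_tail_le [IsFiniteMeasure F] (hF : MemLp (fun z : ℝ≥0 => (z : ℝ)) 2 F)
    (hmean : ∫ z, (z : ℝ) ∂F = μ) (hμ : 0 < μ)
    (hvar : Var[fun z : ℝ≥0 => (z : ℝ); F] = σ ^ 2) {c : ℝ≥0} (hc : (c : ℝ) = μ / 4)
    {m k : ℕ} (hk : 8 ≤ (2 : ℝ) ^ k) (hmk : 64 * (m * (σ ^ 2 / μ ^ 2)) ≤ 2 ^ k) :
    m * ∫⁻ z, z * ind (c * 2 ^ k ≤ z) ∂F ≤ c := by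
  set L := c * 2 ^ k
  have hL : (L : ℝ) = μ / 4 * 2 ^ k := by
    rw [← hc]
    rfl
  have hLpos : 0 < L := NNReal.coe_pos.1 (hL ▸ by positivity)
  have hmeanL : 2 * ∫ z, (z : ℝ) ∂F ≤ L := by
    rw [hmean, hL]
    nlinarith
  calc m * ∫⁻ z, z * ind (L ≤ z) ∂F ≤ m * ENNReal.ofReal (4 / L * σ ^ 2) := by
        gcongr
        exact hvar ▸ lintegral_tail_le hF hLpos hmeanL
    _ = ENNReal.ofReal (64 * (m * (σ ^ 2 / μ ^ 2)) / 2 ^ k * (μ / 4)) := by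
        rw [← ENNReal.ofReal_natCast, ← ENNReal.ofReal_mul (Nat.cast_nonneg m), hL]
        congr 1
        field_simp
        ring
    _ ≤ ENNReal.ofReal c := ENNReal.ofReal_le_ofReal <| hc ▸
        mul_le_of_le_one_left (by positivity) ((div_le_one (by positivity)).2 hmk)
    _ = c := ENNReal.ofReal_coe_nnreal

end SecondMoment

lemma one_le_logRate (m : ℕ) (μ σ : ℝ) : 1 ≤ logRate m μ σ := by
  unfold logRate
  split_ifs
  · exact le_rfl
  · exact le_max_left _ _

lemma mul_div_le_exp_logRate [NeZero m] {μ : ℝ} (hμ : 0 < μ) (σ : ℝ) :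
    m * (σ ^ 2 / μ ^ 2) ≤ Real.exp (logRate m μ σ) := by
  by_cases hσ : σ = 0
  · simp [hσ, Real.exp_nonneg]
  · have hm : (0 : ℝ) < m := Nat.cast_pos.2 (Nat.pos_of_neZero m)
    have hratio : 0 < σ ^ 2 / μ ^ 2 := by positivity
    calc m * (σ ^ 2 / μ ^ 2) = Real.exp (Real.log m + Real.log (σ ^ 2 / μ ^ 2)) := by
          rw [Real.exp_add, Real.exp_log hm, Real.exp_log hratio]
      _ ≤ Real.exp (logRate m μ σ) := by
          rw [logRate, if_neg hσ]
          exact Real.exp_le_exp.2 (le_max_right _ _)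

lemma mul_exp_le_two_pow_ceil {R : ℝ} (hR : 0 ≤ R) :
    64 * Real.exp R ≤ 2 ^ ⌈6 + 2 * R⌉₊ := by
  have hlog : R ≤ Real.log 2 * (2 * R) := by nlinarith [Real.log_two_gt_d9]
  calc 64 * Real.exp R ≤ 64 * Real.exp (Real.log 2 * (2 * R)) := by gcongr
    _ = (2 : ℝ) ^ (6 + 2 * R) := by
        rw [Real.rpow_add two_pos, Real.rpow_def_of_pos two_pos (2 * R)]
        norm_num
    _ ≤ (2 : ℝ) ^ (⌈6 + 2 * R⌉₊ : ℝ) :=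
        Real.rpow_le_rpow_of_exponent_le one_le_two (Nat.le_ceil _)
    _ = 2 ^ ⌈6 + 2 * R⌉₊ := Real.rpow_natCast _ _

lemma natCeil_six_add_two_mul_le {R : ℝ} (hR : 1 ≤ R) : (⌈6 + 2 * R⌉₊ : ℝ) ≤ 9 * R := by
  linarith [Nat.ceil_lt_add_one (show 0 ≤ 6 + 2 * R by linarith)]

end

end AvgDistortion

theorem mainTheorem3 :
    ∃ C : ℝ, 0 < C ∧
      ∀ (F : Measure ℝ≥0) [IsProbabilityMeasure F] (μ σ : ℝ),
        MemLp (fun z : ℝ≥0 => (z : ℝ)) 2 F →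
        ∫ z, (z : ℝ) ∂F = μ → 0 < μ →
        Var[fun z : ℝ≥0 => (z : ℝ); F] = σ ^ 2 →
        ∀ (m : ℕ) [NeZero m],
          ∃ (k : ℕ) (_ : NeZero k) (l : Fin k → ℝ≥0),
            (∀ t, 0 < l t) ∧ StrictMono l ∧
            ∀ (n : ℕ) [NeZero n] (S : Fin k → Profile n m → (Fin n → ℝ≥0) → Fin m),
              (∀ t, IsMeanRule (tailProb F (l t)) (S t)) →
              avgDistortion (rtMean F l S) F ≤ ENNReal.ofReal (C * logRate m μ σ) := by
  refine ⟨5400, by norm_num, fun F _ μ σ hF hmean hμ hvar m _ => ?_⟩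
  set R := logRate m μ σ
  have hR : 1 ≤ R := one_le_logRate m μ σ
  set k := ⌈6 + 2 * R⌉₊
  have : NeZero k := ⟨(Nat.ceil_pos.2 (by linarith)).ne'⟩
  have hpow : 64 * Real.exp R ≤ 2 ^ k := mul_exp_le_two_pow_ceil (by linarith)
  obtain ⟨c, hc⟩ : ∃ c : ℝ≥0, (c : ℝ) = μ / 4 := ⟨⟨μ / 4, by positivity⟩, rfl⟩
  have hc_pos : 0 < c := NNReal.coe_pos.1 (hc ▸ by positivity)
  have hfour : 4 * c = ∫⁻ z, (z : ℝ≥0∞) ∂F := by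
    rw [lintegral_coe_eq_ofReal_integral (hF.integrable one_le_two), hmean,
      show μ = (4 * c : ℝ≥0) by push_cast; linarith, ENNReal.ofReal_coe_nnreal, ENNReal.coe_mul]
    rfl
  have htail : m * ∫⁻ z, z * ind (c * 2 ^ k ≤ z) ∂F ≤ c :=
    mul_lintegral_tail_le hF hmean hμ hvar hc (by linarith [Real.one_le_exp (zero_le_one.trans hR)])
      ((mul_le_mul_of_nonneg_left (mul_div_le_exp_logRate hμ σ) (by norm_num)).trans hpow)
  refine ⟨k, this, fun t => c * 2 ^ (t : ℕ), fun t => by positivity,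
    strictMono_mul_two_pow hc_pos k, fun n _ S hS => ?_⟩
  calc avgDistortion (rtMean F (fun t : Fin k => c * 2 ^ (t : ℕ)) S) F ≤ 600 * k :=
        avgDistortion_rtMean_le hfour.le htail hS
    _ = ENNReal.ofReal (600 * k) := by simp
    _ ≤ ENNReal.ofReal (5400 * R) :=
        ENNReal.ofReal_le_ofReal (by linarith [natCeil_six_add_two_mul_le hR])
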